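/- \textbf{Theorem 8 (Refined Upper Bounds).} Let $1\le k\le n$. Jobs arrive according to a Poisson process of rate $\lambda>0$ at a system of $n$ nodes, each with an unlimited first-come-first-served sub-queue. Each job is split on arrival into $n$ sub-tasks, one for each node; all service times are i.i.d. nonnegative random variables, independent of the arrivals, and the system is empty at time $0$. In the purging $(n,k)$ fork-join queue, a job departs when $k$ of its $n$ sub-tasks are finished, and at that moment its remaining sub-tasks are removed from the sub-queues and from service. In the basic $(i,i)$ fork-join queue there are $i$ nodes and a job departs when all of its $i$ sub-tasks are finished. Let $\mathbb{PT}_{n,k}$ be the expectation of the stable sojourn time (the limit in distribution, as $j\to\infty$, of the sojourn time of the $j$-th job) in the purging $(n,k)$ queue, and let $\mathbb T_i$ be the expectation of the stable sojourn time in the basic $(i,i)$ queue with the same $\lambda$ and the same service time distribution; such an expectation is $+\infty$ if the limit does not exist. Let $X_{(n,k)}$ be the $k$-th smallest of $n$ i.i.d. service times $X_1,\dots,X_n$, and put $$W_i^{n,k}=\sum_{j=k}^{i}\binom nj A_i^{n,j},\qquad A_k^{n,k}=1,\qquad A_i^{n,k}=-\sum_{j=1}^{i-k}\binom{n-i+j}{j}A_{i-j}^{n,k}\quad(k<i\le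 n).$$ Then $$\mathbb{PT}_{n,k}\le\begin{cases}\displaystyle\sum_{i=k}^{n}W_i^{n,k}\,\mathbb T_i, & \lambda\ge \dfrac1{E[X_{(n,k)}]},\\[2mm] \displaystyle\min\left(\sum_{i=k}^{n}W_i^{n,k}\,\mathbb T_i,\ E[X_{(n,k)}]+\frac{\lambda E[X_{(n,k)}^2]}{2(1-\lambda E[X_{(n,k)}])}\right), & \text{otherwise.}\end{cases}$$ Here $1/0=\infty$ and $1/\infty=0$, and the naive bound $\sum_{i=k}^{n}W_i^{n,k}\mathbb T_i$ is read as $+\infty$ (no bound) unless $\mathbb T_k,\dots,\mathbb T_n$ are all finite. They are all finite whenever $\lambda E[X_1]<1$ and $E[X_1^2]<\infty$. -/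

import Mathlib

open MeasureTheory ProbabilityTheory Filter Topology BoundedContinuousFunction
open scoped ENNReal

noncomputable section

namespace ForkJoin

/-! ### Order statistics and the coefficients of the linear transformation -/

/-- The `k`-th order statistic (the `k`-th smallest value, `1 ≤ k ≤ n`) of `x 0, …, x (n - 1)`:
the least `t` such that at least `k` of the values are `≤ t`. -/
def orderStat {n : ℕ} (k : ℕ) (x : Fin n → ℝ) : ℝ :=
  sInf {t : ℝ | k ≤ (Finset.univ.filter fun i => x i ≤ t).card}

/-- The coefficients `A^{n,k}_i`, `k ≤ i ≤ n` (and `0` for `i < k`), given by the recurrence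
`A^{n,k}_k = 1`, `A^{n,k}_i = - ∑_{j=1}^{i-k} (n-i+j choose j) A^{n,k}_{i-j}`. -/
def coeffA (n k : ℕ) (i : ℕ) : ℤ :=
  if i = k then 1
  else -∑ j ∈ (Finset.Icc 1 (i - k)).attach,
    ((n - i + j.1).choose j.1 : ℤ) * coeffA n k (i - j.1)
termination_by i
decreasing_by
  have := Finset.mem_Icc.1 j.2
  omega

/-- The coefficients `W^{n,k}_i = ∑_{j=k}^{i} (n choose j) A^{n,j}_i`. -/
def coeffW (n k i : ℕ) : ℤ :=
  ∑ j ∈ Finset.Icc k i, (n.choose j : ℤ) * coeffA n j i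

/-! ### Input of the queues -/

/-- A sample path of the input of a queue with `n` nodes: `(ω j).1` is the time between the
arrivals of jobs `j - 1` and `j` (for `j = 0`: between time `0` and the first arrival), and
`(ω j).2 i` is the service time of the sub-task of job `j` at node `i`. -/
abbrev Path (n : ℕ) : Type := ℕ → ℝ × (Fin n → ℝ)

/-- The law of the input: jobs arrive according to a Poisson process of rate `lam` (i.i.d.
exponential inter-arrival times), all service times are i.i.d. with law `σ`, and the service
times are independent of the arrivals. -/
def inputLaw (lam : ℝ) (σ : Measure ℝ) (n : ℕ) : Measure (Path n) :=
  Measure.infinitePi fun _ : ℕ => (expMeasure lam).prod (Measure.pi fun _ : Fin n => σ)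

/-- The arrival time of job `j`. -/
def arrival {n : ℕ} (ω : Path n) (j : ℕ) : ℝ :=
  ∑ m ∈ Finset.range (j + 1), (ω m).1

/-! ### Queue dynamics (all queues are empty at time `0`) -/

/-- Basic (or non-purging) fork-join queue: the time at which node `i` starts the sub-task of job
`j`. Each node serves its sub-tasks in order of arrival, and every sub-task is served completely. -/
def basicStart {n : ℕ} (ω : Path n) : ℕ → Fin n → ℝ
  | 0, _ => arrival ω 0
  | j + 1, i => max (arrival ω (j + 1)) (basicStart ω j i + (ω j).2 i)

/-- Sojourn time of job `j` in the basic `(n,n)` fork-join queue: the job departs when all of its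
`n` sub-tasks are finished. -/
def basicSojourn (n : ℕ) (j : ℕ) (ω : Path n) : ℝ :=
  orderStat n (fun i => basicStart ω j i + (ω j).2 i) - arrival ω j

/-- Purging `(n,k)` fork-join queue: the time at which node `i` becomes available to the sub-task
of job `j`, once this job has arrived. A sub-task leaves its node when it is finished or when its
job has received its `k`-th answer, whichever comes first (in the latter case the rest of its
service, or all of it, is cancelled); the next sub-task in the sub-queue then takes its place. -/
def purgingStart {n : ℕ} (k : ℕ) (ω : Path n) : ℕ → Fin n → ℝ
  | 0, _ => arrival ω 0
  | j + 1, i =>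
    max (arrival ω (j + 1))
      (min (purgingStart k ω j i + (ω j).2 i)
        (orderStat k fun m => purgingStart k ω j m + (ω j).2 m))

/-- Sojourn time of job `j` in the purging `(n,k)` fork-join queue: the job departs when `k` of its
`n` sub-tasks are finished. -/
def purgingSojourn (n k : ℕ) (j : ℕ) (ω : Path n) : ℝ :=
  orderStat k (fun i => purgingStart k ω j i + (ω j).2 i) - arrival ω j

/-! ### Stable (limiting) sojourn times and their expectations -/

/-- `ν` is the law of the limit in distribution of the random variables `t j` as `j → ∞`. -/
def IsStableLaw {Ω : Type*} [MeasurableSpace Ω] (P : Measure Ω) (t : ℕ → Ω → ℝ)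
    (ν : Measure ℝ) : Prop :=
  IsProbabilityMeasure ν ∧
    ∀ f : ℝ →ᵇ ℝ, Tendsto (fun j => ∫ ω, f (t j ω) ∂P) atTop (𝓝 (∫ x, f x ∂ν))

open Classical in
/-- The expectation of the stable sojourn time, i.e. of the limit in distribution of the sojourn
time `t j` of the `j`-th job as `j → ∞`. It is `∞` if there is no stable sojourn time. -/
def stableMean {Ω : Type*} [MeasurableSpace Ω] (P : Measure Ω) (t : ℕ → Ω → ℝ) : ℝ≥0∞ :=
  if h : ∃ ν : Measure ℝ, IsStableLaw P t ν then ∫⁻ x, ENNReal.ofReal x ∂h.choose else ⊤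

/-- The limit law is unique, so `stableMean` does not depend on a choice. -/
theorem stableMean_eq {Ω : Type*} [MeasurableSpace Ω] {P : Measure Ω} {t : ℕ → Ω → ℝ}
    {ν : Measure ℝ} (h : IsStableLaw P t ν) :
    stableMean P t = ∫⁻ x, ENNReal.ofReal x ∂ν := by
  have h0 : ∃ ν : Measure ℝ, IsStableLaw P t ν := ⟨ν, h⟩
  have h1 := h0.choose_spec
  have e : h0.choose = ν := by
    have := h.1
    have := h1.1
    exact ext_of_forall_integral_eq_of_IsFiniteMeasure
      fun f => tendsto_nhds_unique (h1.2 f) (h.2 f)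
  rw [stableMean, dif_pos h0, e]

/-- `T_i`: expected sojourn time of the basic `(i,i)` fork-join queue. -/
def basicMean (lam : ℝ) (σ : Measure ℝ) (i : ℕ) : ℝ≥0∞ :=
  stableMean (inputLaw lam σ i) (basicSojourn i)

/-- `PT_{n,k}`: expected sojourn time of the purging `(n,k)` fork-join queue. -/
def purgingMean (lam : ℝ) (σ : Measure ℝ) (n k : ℕ) : ℝ≥0∞ :=
  stableMean (inputLaw lam σ n) (purgingSojourn n k)

/-! ### The two bounds -/

/-- `E[X_{(n,k)} ^ p]` for the `k`-th order statistic `X_{(n,k)}` of `n` i.i.d. nonnegative random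
variables with law `σ`. -/
def orderStatMoment (σ : Measure ℝ) (n k p : ℕ) : ℝ≥0∞ :=
  ∫⁻ x : Fin n → ℝ, ENNReal.ofReal (orderStat k x) ^ p ∂(Measure.pi fun _ : Fin n => σ)

open Classical in
/-- The naive bound `∑_{i=k}^n W^{n,k}_i T_i`; it is `∞` (no bound) unless all `T_i` are finite. -/
def naiveBound (lam : ℝ) (σ : Measure ℝ) (n k : ℕ) : EReal :=
  if ∀ i ∈ Finset.Icc k n, basicMean lam σ i ≠ ⊤ then
    ((∑ i ∈ Finset.Icc k n, (coeffW n k i : ℝ) * (basicMean lam σ i).toReal : ℝ) : EReal)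
  else ⊤

/-- The split-merge bound `E[X_{(n,k)}] + lam E[X_{(n,k)}²] / (2 (1 - lam E[X_{(n,k)}]))`, for
`lam E[X_{(n,k)}] < 1`. -/
def splitMergeBound (lam : ℝ) (σ : Measure ℝ) (n k : ℕ) : ℝ≥0∞ :=
  orderStatMoment σ n k 1 + ENNReal.ofReal lam * orderStatMoment σ n k 2 /
    (2 * (1 - ENNReal.ofReal lam * orderStatMoment σ n k 1))

end ForkJoin

end

noncomputable section

namespace ForkJoin

/-! ### Order statistics -/

/-! Both bounds rest on reading the input backwards in time (Loynes' construction). The sojourn time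
of job `j` has the law of `backwardSojourn k j`, and this is increasing in `j` on every sample path.
Hence the stable mean is the supremum over `j` of the expectations, whether or not a limit law
exists (`stableMean_eq_iSup`), and it suffices to bound the expectation for each fixed `j`.

Naive bound: cancelling sub-tasks only shortens delays, so the sojourn time is at most the `k`-th
order statistic of the nodes' completion delays without purging. Inclusion-exclusion writes this
order statistic as a signed sum of maxima over sets of nodes (`orderStat_eq_sum_maxOver`). Without
purging the nodes do not interact, so `i` of them form a basic `(i,i)` queue, and the total weight
of the `i`-element sets is `coeffW n k i`. The identity is integrated at fixed `j`, and then `j →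
∞`.

Split-merge bound: under purging every node is free of a job once that job departs, so the queue is
dominated by a single-server queue whose service times are the `k`-th order statistics. The mean
wait there is bounded as in the Pollaczek–Khinchine formula, by comparing second moments of
successive jobs (`waitMoment_one_le`). Applied to one node, the same bound shows that the basic
means are finite. -/

theorem isClosed_orderStat_set {n : ℕ} (k : ℕ) (x : Fin n → ℝ) :
    IsClosed {t : ℝ | k ≤ (Finset.univ.filter fun i => x i ≤ t).card} := by
  have h : {t : ℝ | k ≤ (Finset.univ.filter fun i => x i ≤ t).card} =
      ⋃ S ∈ {S : Finset (Fin n) | k ≤ S.card}, ⋂ i ∈ S, Set.Ici (x i) := by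
    ext t
    simp only [Set.mem_ofPred_eq, Set.mem_iUnion, Set.mem_iInter, Set.mem_Ici, exists_prop]
    constructor
    · exact fun h => ⟨_, h, fun i hi => (Finset.mem_filter.1 hi).2⟩
    · rintro ⟨S, hS, h⟩
      exact hS.trans (Finset.card_le_card fun i hi => by simpa using h i hi)
  rw [h]
  exact (Set.toFinite _).isClosed_biUnion fun S _ =>
    isClosed_biInter fun i _ => isClosed_Ici

/-- The defining set is closed, nonempty and bounded below, so its infimum is attained. The
elementary properties of `orderStat` are read off from this counting criterion. -/
theorem orderStat_le_iff {n k : ℕ} (hk : 1 ≤ k) (hkn : k ≤ n) (x : Fin n → ℝ) (t : ℝ) :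
    orderStat k x ≤ t ↔ k ≤ (Finset.univ.filter fun i => x i ≤ t).card := by
  have hne : {t : ℝ | k ≤ (Finset.univ.filter fun i => x i ≤ t).card}.Nonempty := by
    obtain ⟨b, hb⟩ := (Set.finite_range x).bddAbove
    refine ⟨b, ?_⟩
    have : (Finset.univ.filter fun i => x i ≤ b) = Finset.univ :=
      Finset.filter_true_of_mem fun i _ => hb ⟨i, rfl⟩
    simpa [this] using hkn
  have hbdd : BddBelow {t : ℝ | k ≤ (Finset.univ.filter fun i => x i ≤ t).card} := by
    obtain ⟨b, hb⟩ := (Set.finite_range x).bddBelow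
    refine ⟨b, fun t ht => ?_⟩
    obtain ⟨i, hi⟩ := Finset.card_pos.1 (lt_of_lt_of_le hk ht)
    exact (hb ⟨i, rfl⟩).trans (Finset.mem_filter.1 hi).2
  constructor
  · intro h
    refine le_trans ((isClosed_orderStat_set k x).csInf_mem hne hbdd) (Finset.card_le_card ?_)
    intro i hi
    simp only [Finset.mem_filter, Finset.mem_univ, true_and] at hi ⊢
    exact hi.trans h
  · exact fun h => csInf_le hbdd h

theorem orderStat_mono {n k : ℕ} (hk : 1 ≤ k) (hkn : k ≤ n) {x y : Fin n → ℝ} (h : x ≤ y) :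
    orderStat k x ≤ orderStat k y := by
  rw [orderStat_le_iff hk hkn]
  refine le_trans ((orderStat_le_iff hk hkn y _).1 le_rfl) (Finset.card_le_card ?_)
  intro i hi
  simp only [Finset.mem_filter, Finset.mem_univ, true_and] at hi ⊢
  exact (h i).trans hi

theorem orderStat_add_const {n k : ℕ} (hk : 1 ≤ k) (hkn : k ≤ n) (x : Fin n → ℝ) (c : ℝ) :
    orderStat k (fun i => x i + c) = orderStat k x + c := by
  refine eq_of_forall_ge_iff fun t => ?_
  rw [orderStat_le_iff hk hkn, ← le_sub_iff_add_le, orderStat_le_iff hk hkn]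
  simp only [le_sub_iff_add_le]

theorem orderStat_nonneg {n k : ℕ} (hk : 1 ≤ k) (hkn : k ≤ n) {x : Fin n → ℝ}
    (h : ∀ i, 0 ≤ x i) : 0 ≤ orderStat k x := by
  obtain ⟨i, hi⟩ := Finset.card_pos.1 (lt_of_lt_of_le hk ((orderStat_le_iff hk hkn x _).1 le_rfl))
  exact (h i).trans (Finset.mem_filter.1 hi).2

theorem measurable_orderStat {n k : ℕ} (hk : 1 ≤ k) (hkn : k ≤ n) :
    Measurable (orderStat k : (Fin n → ℝ) → ℝ) := by
  refine measurable_of_Iic fun t => ?_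
  have h : orderStat k ⁻¹' Set.Iic t =
      ⋃ S ∈ {S : Finset (Fin n) | k ≤ S.card}, ⋂ i ∈ S, {x : Fin n → ℝ | x i ≤ t} := by
    ext x
    simp only [Set.mem_preimage, Set.mem_Iic, orderStat_le_iff hk hkn, Set.mem_ofPred_eq,
      Set.mem_iUnion, Set.mem_iInter, exists_prop]
    constructor
    · exact fun h => ⟨_, h, fun i hi => (Finset.mem_filter.1 hi).2⟩
    · rintro ⟨S, hS, h⟩
      exact hS.trans (Finset.card_le_card fun i hi => by simpa using h i hi)
  rw [h]
  exact MeasurableSet.biUnion (Set.to_countable _) fun S _ =>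
    Finset.measurableSet_biInter _ fun i _ => measurableSet_le (measurable_pi_apply i)
      measurable_const

theorem orderStat_card_le_iff {n : ℕ} (hn : 1 ≤ n) (x : Fin n → ℝ) (t : ℝ) :
    orderStat n x ≤ t ↔ ∀ i, x i ≤ t := by
  have h : n ≤ (Finset.univ.filter fun i => x i ≤ t).card ↔
      (Finset.univ.filter fun i => x i ≤ t) = Finset.univ := by
    rw [← Finset.card_eq_iff_eq_univ, Fintype.card_fin]
    have := Finset.card_le_univ (Finset.univ.filter fun i => x i ≤ t)
    rw [Fintype.card_fin] at this
    omega
  rw [orderStat_le_iff hn le_rfl, h, Finset.filter_eq_self]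
  simp

theorem le_orderStat_card {n : ℕ} (hn : 1 ≤ n) (x : Fin n → ℝ) (i : Fin n) :
    x i ≤ orderStat n x :=
  (orderStat_card_le_iff hn x _).1 le_rfl i

/-- The maximum of `x` over the index set `S`. -/
def maxOver {n : ℕ} (S : Finset (Fin n)) (x : Fin n → ℝ) : ℝ :=
  orderStat S.card fun m => x (S.orderEmbOfFin rfl m)

theorem maxOver_le_iff {n : ℕ} {S : Finset (Fin n)} (hS : 1 ≤ S.card) (x : Fin n → ℝ) (t : ℝ) :
    maxOver S x ≤ t ↔ ∀ i ∈ S, x i ≤ t := by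
  rw [maxOver, orderStat_card_le_iff hS]
  constructor
  · intro h i hi
    have : i ∈ Set.range (S.orderEmbOfFin rfl) := by rw [Finset.range_orderEmbOfFin]; exact hi
    obtain ⟨m, rfl⟩ := this
    exact h m
  · exact fun h m => h _ (Finset.orderEmbOfFin_mem S rfl m)

/-! ### Inclusion-exclusion for order statistics -/

/-- Terms with `i > N` vanish; in the others `C(N,i) C(i,j) = C(N,j) C(N-j,i-j)` leaves the
alternating sum of row `N - j` of Pascal's triangle. -/
theorem sum_alternating_choose_mul_choose {n N j : ℕ} (hN : N ≤ n) :
    ∑ i ∈ Finset.Icc j n, (-1 : ℤ) ^ (i - j) * i.choose j * N.choose i =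
      if j = N then 1 else 0 := by
  rcases lt_or_ge N j with h | h
  · rw [if_neg (by omega)]
    refine Finset.sum_eq_zero fun i hi => ?_
    rw [Nat.choose_eq_zero_of_lt (show N < i by have := Finset.mem_Icc.1 hi; omega)]
    simp
  have h1 : ∑ i ∈ Finset.Icc j n, (-1 : ℤ) ^ (i - j) * i.choose j * N.choose i =
      ∑ i ∈ Finset.Icc j N, (-1 : ℤ) ^ (i - j) * i.choose j * N.choose i := by
    symm
    refine Finset.sum_subset (Finset.Icc_subset_Icc_right hN) fun i hi hi' => ?_
    rw [Nat.choose_eq_zero_of_lt (show N < i by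
      simp only [Finset.mem_Icc] at hi hi'; omega)]
    simp
  have h2 : ∑ i ∈ Finset.Icc j N, (-1 : ℤ) ^ (i - j) * i.choose j * N.choose i =
      ∑ m ∈ Finset.range (N - j + 1), (N.choose j : ℤ) * ((-1 : ℤ) ^ m * (N - j).choose m) := by
    rw [← Finset.Ico_add_one_right_eq_Icc, Finset.sum_Ico_eq_sum_range,
      show N + 1 - j = N - j + 1 by omega]
    refine Finset.sum_congr rfl fun m hm => ?_
    have hm' : m ≤ N - j := Nat.lt_succ_iff.1 (Finset.mem_range.1 hm)
    have := Nat.choose_mul (n := N) (k := j + m) (s := j) (by omega)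
    rw [show j + m - j = m by omega] at this ⊢
    have h3 : (N.choose (j + m) : ℤ) * (j + m).choose j = N.choose j * (N - j).choose m := by
      exact_mod_cast this
    linear_combination (-1 : ℤ) ^ m * h3
  rw [h1, h2, ← Finset.mul_sum, Int.alternating_sum_range_choose]
  by_cases hj : j = N
  · simp [hj]
  · rw [if_neg (by omega), if_neg hj, mul_zero]

/-- By induction, each term of the recurrence has the common factor `C(n-k,i-k)`. What remains is an
alternating row sum, which is zero, with its `j = 0` term moved to the other side. -/
theorem coeffA_eq (n k : ℕ) : ∀ i, k ≤ i → i ≤ n →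
    coeffA n k i = (-1) ^ (i - k) * (n - k).choose (i - k) := by
  intro i
  induction i using Nat.strong_induction_on with
  | _ i ih =>
    intro hki hin
    rw [coeffA]
    split_ifs with h
    · simp [h]
    rw [Finset.sum_attach (Finset.Icc 1 (i - k))
      (fun j => ((n - i + j).choose j : ℤ) * coeffA n k (i - j))]
    have h1 : ∀ j ∈ Finset.Icc 1 (i - k), ((n - i + j).choose j : ℤ) * coeffA n k (i - j) =
        (n - k).choose (i - k) * ((-1) ^ (i - k - j) * (i - k).choose j) := by
      intro j hj
      have hj := Finset.mem_Icc.1 hj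
      rw [ih (i - j) (by omega) (by omega) (by omega)]
      have h2 := Nat.choose_mul (n := n - k) (k := i - k) (s := i - k - j) (by omega)
      rw [show n - k - (i - k - j) = n - i + j by omega,
        show i - k - (i - k - j) = j by omega] at h2
      have h4 : (i - k).choose (i - k - j) = (i - k).choose j := Nat.choose_symm (by omega)
      rw [h4] at h2
      have h3 : ((n - k).choose (i - k) : ℤ) * (i - k).choose j =
        (n - k).choose (i - k - j) * (n - i + j).choose j := by exact_mod_cast h2
      rw [show i - j - k = i - k - j by omega]
      linear_combination -(-1 : ℤ) ^ (i - k - j) * h3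
    rw [Finset.sum_congr rfl h1, ← Finset.mul_sum]
    have h5 : ∑ j ∈ Finset.range (i - k + 1), ((-1 : ℤ) ^ (i - k - j) * (i - k).choose j) = 0 := by
      rw [← Finset.sum_range_reflect, ← Int.alternating_sum_range_choose_of_ne
        (show i - k ≠ 0 by omega)]
      refine Finset.sum_congr rfl fun j hj => ?_
      have hj := Finset.mem_range.1 hj
      rw [show i - k + 1 - 1 - j = i - k - j by omega, show i - k - (i - k - j) = j by omega,
        Nat.choose_symm (by omega)]
    rw [Finset.range_eq_Ico, Finset.sum_eq_sum_Ico_succ_bot (Nat.succ_pos _), zero_add,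
      Nat.succ_eq_add_one, Finset.Ico_add_one_right_eq_Icc] at h5
    simp only [Nat.sub_zero, Nat.choose_zero_right, Nat.cast_one, mul_one] at h5
    linear_combination -((n - k).choose (i - k) : ℤ) * h5

/-- The coefficient of the maxima over `i`-element sets in the `k`-th order statistic. -/
def maxCoeff (k i : ℕ) : ℤ := ∑ j ∈ Finset.Icc k i, (-1 : ℤ) ^ (i - j) * i.choose j

/-- There are `C(n,i)` sets of `i` nodes, each entering with the weight `maxCoeff k i`, which does
not depend on `n`. -/
theorem coeffW_eq {n k i : ℕ} (hin : i ≤ n) :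
    coeffW n k i = n.choose i * maxCoeff k i := by
  rw [coeffW, maxCoeff, Finset.mul_sum]
  refine Finset.sum_congr rfl fun j hj => ?_
  have hj := Finset.mem_Icc.1 hj
  rw [coeffA_eq n j i hj.2 hin]
  have h : (n.choose i : ℤ) * i.choose j = n.choose j * (n - j).choose (i - j) := by
    exact_mod_cast Nat.choose_mul (n := n) (k := i) (s := j) hj.2
  linear_combination -(-1 : ℤ) ^ (i - j) * h

theorem sum_maxCoeff_mul_choose {n N k : ℕ} (hN : N ≤ n) :
    ∑ i ∈ Finset.Icc k n, maxCoeff k i * N.choose i = if k ≤ N then 1 else 0 := by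
  simp only [maxCoeff, Finset.sum_mul]
  rw [Finset.sum_comm' (t' := Finset.Icc k n) (s' := fun j => Finset.Icc j n)]
  · simp only [sum_alternating_choose_mul_choose hN, Finset.sum_ite_eq', Finset.mem_Icc, hN,
      and_true]
  · intro i j
    simp only [Finset.mem_Icc]
    omega

theorem sum_powersetCard_maxOver_le {n i : ℕ} (hi : 1 ≤ i) (x : Fin n → ℝ) (t : ℝ) :
    ∑ S ∈ Finset.powersetCard i Finset.univ, (if maxOver S x ≤ t then (1 : ℤ) else 0) =
      (Finset.univ.filter fun i => x i ≤ t).card.choose i := by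
  rw [← Finset.card_powersetCard, Finset.sum_boole]
  congr 2
  ext S
  simp only [Finset.mem_filter, Finset.mem_powersetCard, Finset.subset_univ, true_and]
  constructor
  · rintro ⟨rfl, h⟩
    rw [maxOver_le_iff hi] at h
    exact ⟨fun m hm => by simpa using h m hm, rfl⟩
  · rintro ⟨h, rfl⟩
    refine ⟨rfl, (maxOver_le_iff hi _ _).2 fun m hm => by simpa using h hm⟩

/-- If `N` coordinates are at most `t`, then exactly `C(N,i)` of the `i`-element sets have maximum
at most `t`, so both sides depend on `N` alone and `sum_maxCoeff_mul_choose` applies. -/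
theorem indicator_orderStat_le {n k : ℕ} (hk : 1 ≤ k) (hkn : k ≤ n) (x : Fin n → ℝ) (t : ℝ) :
    (if orderStat k x ≤ t then (1 : ℤ) else 0) = ∑ i ∈ Finset.Icc k n, maxCoeff k i *
      ∑ S ∈ Finset.powersetCard i Finset.univ, (if maxOver S x ≤ t then (1 : ℤ) else 0) := by
  have hN : (Finset.univ.filter fun i => x i ≤ t).card ≤ n :=
    (Finset.card_le_univ _).trans_eq (Fintype.card_fin n)
  simp only [orderStat_le_iff hk hkn]
  rw [← sum_maxCoeff_mul_choose hN]
  refine Finset.sum_congr rfl fun i hi => ?_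
  rw [sum_powersetCard_maxOver_le (hk.trans (Finset.mem_Icc.1 hi).1)]

theorem integral_indicator_le {a M : ℝ} (ha : 0 ≤ a) (haM : a ≤ M) :
    ∫ t in Set.Ioc 0 M, (if a ≤ t then (1 : ℝ) else 0) = M - a := by
  have h : (fun t : ℝ => if a ≤ t then (1 : ℝ) else 0) = (Set.Ici a).indicator 1 := by
    ext t; simp [Set.indicator_apply]
  rw [h, integral_indicator_one measurableSet_Ici, Measure.real,
    Measure.restrict_apply measurableSet_Ici]
  have h2 : volume (Set.Ici a ∩ Set.Ioc 0 M) = volume (Set.Icc a M) := by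
    rw [← measure_congr (Ioo_ae_eq_Icc (a := a) (b := M))]
    refine le_antisymm ?_ (measure_mono fun t ht => ⟨ht.1.le, ha.trans_lt ht.1, ht.2.le⟩)
    rw [measure_congr (Ioo_ae_eq_Icc (a := a) (b := M))]
    exact measure_mono fun t ht => ⟨ht.1, ht.2.2⟩
  rw [h2, Real.volume_Icc, ENNReal.toReal_ofReal (by linarith)]

/-- Integrate the indicator identity over `(0, b]` with `b` an upper bound of all coordinates: an
indicator `a ≤ t` contributes `b - a`. -/
theorem orderStat_eq_sum_maxOver {n k : ℕ} (hk : 1 ≤ k) (hkn : k ≤ n) {x : Fin n → ℝ}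
    (hx : ∀ i, 0 ≤ x i) :
    orderStat k x = ∑ i ∈ Finset.Icc k n, (maxCoeff k i : ℝ) *
      ∑ S ∈ Finset.powersetCard i Finset.univ, maxOver S x := by
  obtain ⟨b, hb⟩ := (Set.finite_range x).bddAbove
  have hn : 1 ≤ n := hk.trans hkn
  have hb0 : 0 ≤ b := (hx ⟨0, hn⟩).trans (hb ⟨_, rfl⟩)
  have hb' : ∀ i, x i ≤ b := fun i => hb ⟨i, rfl⟩
  have hint : ∀ a : ℝ, IntegrableOn (fun t : ℝ => if a ≤ t then (1 : ℝ) else 0)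
      (Set.Ioc 0 b) := by
    intro a
    refine Measure.integrableOn_of_bounded (M := 1) (by simp) ?_ ?_
    · exact (Measurable.ite measurableSet_Ici measurable_const measurable_const).aestronglyMeasurable
    · exact Eventually.of_forall fun t => by split_ifs <;> simp
  have h1 : ∀ t : ℝ, (if orderStat k x ≤ t then (1 : ℝ) else 0) =
      ∑ i ∈ Finset.Icc k n, (maxCoeff k i : ℝ) *
      ∑ S ∈ Finset.powersetCard i Finset.univ, (if maxOver S x ≤ t then (1 : ℝ) else 0) :=
    fun t => by exact_mod_cast congrArg (Int.cast : ℤ → ℝ) (indicator_orderStat_le hk hkn x t)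
  have hM : ∀ i ∈ Finset.Icc k n, ∀ S ∈ Finset.powersetCard i (Finset.univ : Finset (Fin n)),
      0 ≤ maxOver S x ∧ maxOver S x ≤ b := by
    intro i hi S hS
    have hc : 1 ≤ S.card := by
      rw [(Finset.mem_powersetCard.1 hS).2]; exact hk.trans (Finset.mem_Icc.1 hi).1
    exact ⟨orderStat_nonneg hc le_rfl fun m => hx _, (maxOver_le_iff hc _ _).2 fun m _ => hb' m⟩
  have hk0 : orderStat k x ≤ b := by
    rw [orderStat_le_iff hk hkn, Finset.filter_true_of_mem fun i _ => hb' i]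
    simpa using hkn
  have h2 := integral_indicator_le (orderStat_nonneg hk hkn hx) hk0
  simp only [h1] at h2
  rw [integral_finsetSum _ fun i _ => (integrable_finsetSum _ fun S _ => hint _).const_mul _] at h2
  have h3 : ∀ i ∈ Finset.Icc k n, ∫ t in Set.Ioc 0 b, (maxCoeff k i : ℝ) *
      ∑ S ∈ Finset.powersetCard i Finset.univ, (if maxOver S x ≤ t then (1 : ℝ) else 0) =
      (maxCoeff k i * n.choose i : ℝ) * b - (maxCoeff k i : ℝ) *
      ∑ S ∈ Finset.powersetCard i Finset.univ, maxOver S x := by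
    intro i hi
    rw [integral_const_mul, integral_finsetSum _ fun S _ => hint _,
      Finset.sum_congr rfl fun S hS => integral_indicator_le (hM i hi S hS).1 (hM i hi S hS).2,
      Finset.sum_sub_distrib, Finset.sum_const, Finset.card_powersetCard, Finset.card_univ,
      Fintype.card_fin, nsmul_eq_mul]
    ring
  -- The weights sum to one (case `N = n`), so the terms in `b` cancel.
  have h4 : ∑ i ∈ Finset.Icc k n, (maxCoeff k i * n.choose i : ℝ) = 1 := by
    have := sum_maxCoeff_mul_choose (n := n) (N := n) (k := k) le_rfl
    rw [if_pos hkn] at this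
    exact_mod_cast this
  rw [Finset.sum_congr rfl h3, Finset.sum_sub_distrib, ← Finset.sum_mul, h4, one_mul] at h2
  linarith

/-! ### Limits in distribution of stochastically monotone sequences -/

theorem iSup_lintegral_le_of_isStableLaw {Ω : Type*} [MeasurableSpace Ω] {P : Measure Ω}
    [IsProbabilityMeasure P] {t Y : ℕ → Ω → ℝ} (ht : ∀ j, IdentDistrib (t j) (Y j) P P)
    (hmono : ∀ ω, Monotone fun j => Y j ω) {ν : Measure ℝ} (hν : IsStableLaw P t ν) :
    ⨆ j, ∫⁻ ω, ENNReal.ofReal (Y j ω) ∂P ≤ ∫⁻ x, ENNReal.ofReal x ∂ν := by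
  have := hν.1
  -- Bounded continuous truncations of the positive part, increasing to it, so that weak convergence
  -- controls each one and monotone convergence restores the mean.
  let f (N : ℕ) : ℝ →ᵇ ℝ := BoundedContinuousFunction.ofNormedAddCommGroup
    (fun x : ℝ => min (max x 0) N) (by fun_prop) N (fun x => by
      rw [Real.norm_of_nonneg (le_min (le_max_right _ _) N.cast_nonneg)]
      exact min_le_right _ _)
  have hf : ∀ N x, f N x = min (max x 0) N := fun N x => rfl
  have hf0 : ∀ N x, 0 ≤ f N x := fun N x => le_min (le_max_right _ _) N.cast_nonneg
  have hle : ∀ N x, ENNReal.ofReal (f N x) ≤ ENNReal.ofReal x := by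
    intro N x
    rcases le_total 0 x with h | h
    · exact ENNReal.ofReal_le_ofReal (by rw [hf, max_eq_left h]; exact min_le_left _ _)
    · rw [hf, max_eq_right h, min_eq_left N.cast_nonneg]; simp
  have hsup : ∀ x, ⨆ N, ENNReal.ofReal (f N x) = ENNReal.ofReal x := by
    intro x
    refine le_antisymm (iSup_le fun N => hle N x) ?_
    obtain ⟨N, hN⟩ := exists_nat_ge (max x 0)
    refine le_trans (ENNReal.ofReal_le_ofReal ?_) (le_iSup (fun N => ENNReal.ofReal (f N x)) N)
    rw [hf, min_eq_left hN]; exact le_max_left _ _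
  have hfm : Monotone fun N x => ENNReal.ofReal (f N x) := fun N M h x =>
    ENNReal.ofReal_le_ofReal (min_le_min le_rfl (by exact_mod_cast h))
  have hYm : ∀ j, AEMeasurable (Y j) P := fun j => (ht j).aemeasurable_snd
  have hint : ∀ N j, Integrable (fun ω => f N (Y j ω)) P := fun N j =>
    Integrable.of_bound (((f N).continuous.measurable.comp_aemeasurable
      (hYm j)).aestronglyMeasurable) N (Eventually.of_forall fun ω => by
        rw [Real.norm_of_nonneg (hf0 _ _)]; exact min_le_right _ _)
  refine iSup_le fun j => ?_
  have h1 : ∀ N, ∫ ω, f N (Y j ω) ∂P ≤ ∫ x, f N x ∂ν := by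
    intro N
    refine ge_of_tendsto (hν.2 (f N)) ((eventually_ge_atTop j).mono fun m hm => ?_)
    have : ∫ ω, f N (t m ω) ∂P = ∫ ω, f N (Y m ω) ∂P :=
      ((ht m).comp (f N).continuous.measurable).integral_eq
    rw [this]
    exact integral_mono (hint _ _) (hint _ _) fun ω =>
      min_le_min (max_le_max (hmono ω hm) le_rfl) le_rfl
  calc ∫⁻ ω, ENNReal.ofReal (Y j ω) ∂P
      = ∫⁻ ω, ⨆ N, ENNReal.ofReal (f N (Y j ω)) ∂P := by simp only [hsup]
    _ = ⨆ N, ∫⁻ ω, ENNReal.ofReal (f N (Y j ω)) ∂P :=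
        lintegral_iSup' (fun N => ((f N).continuous.measurable.comp_aemeasurable
          (hYm j)).ennreal_ofReal) (Eventually.of_forall fun ω N M h => hfm h (Y j ω))
    _ ≤ ∫⁻ x, ENNReal.ofReal x ∂ν := iSup_le fun N => by
        rw [← ofReal_integral_eq_lintegral_ofReal (hint N j)
          (Eventually.of_forall fun ω => hf0 _ _)]
        refine (ENNReal.ofReal_le_ofReal (h1 N)).trans ?_
        rw [ofReal_integral_eq_lintegral_ofReal ((f N).integrable ν)
          (Eventually.of_forall fun ω => hf0 _ _)]
        exact lintegral_mono fun x => hle N x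

/-- If the supremum is finite, `Y j` converges almost surely to its supremum, whose law is the
stable law. If it is infinite, any stable law has infinite mean, and without one the mean is `⊤` by
convention. -/
theorem stableMean_eq_iSup {Ω : Type*} [MeasurableSpace Ω] {P : Measure Ω}
    [IsProbabilityMeasure P] {t Y : ℕ → Ω → ℝ} (ht : ∀ j, IdentDistrib (t j) (Y j) P P)
    (hY : ∀ j, Measurable (Y j)) (hmono : ∀ ω, Monotone fun j => Y j ω) :
    stableMean P t = ⨆ j, ∫⁻ ω, ENNReal.ofReal (Y j ω) ∂P := by
  refine le_antisymm ?_ ?_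
  · by_cases htop : ⨆ j, ∫⁻ ω, ENNReal.ofReal (Y j ω) ∂P = ⊤
    · rw [htop]; exact le_top
    have hsup : ∫⁻ ω, ⨆ j, ENNReal.ofReal (Y j ω) ∂P = ⨆ j, ∫⁻ ω, ENNReal.ofReal (Y j ω) ∂P :=
      lintegral_iSup (fun j => (hY j).ennreal_ofReal)
        fun i j h ω => ENNReal.ofReal_le_ofReal (hmono ω h)
    have hfin : ∀ᵐ ω ∂P, ⨆ j, ENNReal.ofReal (Y j ω) < ⊤ :=
      ae_lt_top (.iSup fun j => (hY j).ennreal_ofReal) (hsup ▸ htop)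
    have hlim : ∀ᵐ ω ∂P, Tendsto (fun j => Y j ω) atTop (𝓝 (⨆ j, Y j ω)) := by
      filter_upwards [hfin] with ω hω
      refine tendsto_atTop_ciSup (hmono ω) ⟨(⨆ j, ENNReal.ofReal (Y j ω)).toReal, ?_⟩
      rintro _ ⟨j, rfl⟩
      exact (ENNReal.ofReal_le_iff_le_toReal hω.ne).1 (le_iSup (fun j => ENNReal.ofReal (Y j ω)) j)
    have hZ : Measurable fun ω => ⨆ j, Y j ω := .iSup hY
    have hν : IsStableLaw P t (P.map fun ω => ⨆ j, Y j ω) := by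
      refine ⟨Measure.isProbabilityMeasure_map hZ.aemeasurable, fun f => ?_⟩
      rw [integral_map hZ.aemeasurable f.continuous.measurable.aestronglyMeasurable]
      have h1 : ∀ j, ∫ ω, f (t j ω) ∂P = ∫ ω, f (Y j ω) ∂P := fun j =>
        ((ht j).comp f.continuous.measurable).integral_eq
      simp only [h1]
      refine tendsto_integral_of_dominated_convergence (fun _ => ‖f‖)
        (fun j => (f.continuous.measurable.comp (hY j)).aestronglyMeasurable)
        (integrable_const _) (fun j => Eventually.of_forall fun ω => f.norm_coe_le_norm _) ?_
      filter_upwards [hlim] with ω hω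
      exact (f.continuous.tendsto _).comp hω
    rw [stableMean_eq hν, lintegral_map ENNReal.measurable_ofReal hZ, ← hsup]
    refine lintegral_mono_ae ?_
    filter_upwards [hlim] with ω hω
    exact le_of_tendsto ((ENNReal.continuous_ofReal.tendsto _).comp hω)
      (Eventually.of_forall fun j => le_iSup (fun j => ENNReal.ofReal (Y j ω)) j)
  · by_cases h : ∃ ν : Measure ℝ, IsStableLaw P t ν
    · obtain ⟨ν, hν⟩ := h
      rw [stableMean_eq hν]
      exact iSup_lintegral_le_of_isStableLaw ht hmono hν
    · rw [stableMean, dif_neg h]; exact le_top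

/-! ### Time reversal of the queue dynamics -/

/-- One transition of the purging queue: `c i` is the time between the arrival of a job and the
moment at which node `i` would finish its sub-task without purging; `p` consists of the next
inter-arrival time and the service times of the next job. -/
def purgingStep {n : ℕ} (k : ℕ) (p : ℝ × (Fin n → ℝ)) (c : Fin n → ℝ) : Fin n → ℝ :=
  fun i => max 0 (min (c i) (orderStat k c) - p.1) + p.2 i

/-- The state of the purging queue at job `j` when the input is read backwards in time. -/
def backward {n : ℕ} (k : ℕ) : ℕ → Path n → Fin n → ℝ
  | 0, ω => (ω 0).2
  | j + 1, ω => purgingStep k (ω 0) (backward k j fun m => ω (m + 1))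

theorem purgingStep_mono {n k : ℕ} (hk : 1 ≤ k) (hkn : k ≤ n) (p : ℝ × (Fin n → ℝ)) :
    Monotone (purgingStep k p) := fun c d h i => by
  have := orderStat_mono hk hkn h
  have := h i
  unfold purgingStep
  gcongr

/-- Increasing `j` keeps the most recent jobs and adds one older job, and every transition is
monotone in the state it receives. -/
theorem backward_mono {n k : ℕ} (hk : 1 ≤ k) (hkn : k ≤ n) (ω : Path n) :
    Monotone fun j => backward k j ω := by
  refine monotone_nat_of_le_succ fun j => ?_
  induction j generalizing ω with
  | zero => exact fun i => le_add_of_nonneg_left (le_max_left _ _)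
  | succ j ih => exact purgingStep_mono hk hkn _ (ih _)

theorem measurable_backward {n k : ℕ} (hk : 1 ≤ k) (hkn : k ≤ n) (j : ℕ) :
    Measurable (backward k j : Path n → Fin n → ℝ) := by
  induction j with
  | zero => exact (measurable_pi_apply 0).snd
  | succ j ih =>
    have h : Measurable fun ω : Path n => backward k j fun m => ω (m + 1) :=
      ih.comp (measurable_pi_lambda _ fun m => measurable_pi_apply (m + 1))
    refine measurable_pi_lambda _ fun i => ?_
    have h1 : Measurable fun ω : Path n => (ω 0).1 := (measurable_pi_apply 0).fst
    have h2 : Measurable fun ω : Path n => (ω 0).2 i :=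
      (measurable_pi_apply i).comp (measurable_pi_apply 0).snd
    exact (measurable_const.max ((((measurable_pi_apply i).comp h).min
      ((measurable_orderStat hk hkn).comp h)).sub h1)).add h2

theorem backward_nonneg {n k : ℕ} (j : ℕ) {ω : Path n} (h : ∀ m i, 0 ≤ (ω m).2 i) (i : Fin n) :
    0 ≤ backward k j ω i := by
  cases j with
  | zero => exact h 0 i
  | succ j => exact add_nonneg (le_max_left _ _) (h 0 i)

theorem backward_congr {n k : ℕ} (j : ℕ) {ω ω' : Path n} (h : ∀ m ≤ j, ω m = ω' m) :
    backward k j ω = backward k j ω' := by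
  induction j generalizing ω ω' with
  | zero => simp [backward, h 0 le_rfl]
  | succ j ih =>
    rw [backward, backward, h 0 (Nat.zero_le _), ih fun m hm => h (m + 1) (Nat.succ_le_succ hm)]

/-- Measured from the arrival of each job, the dynamics are a Lindley recursion. The reversal fixes
the indices beyond `j`, so it is a permutation and preserves the input law. -/
theorem purgingStart_add_sub_arrival {n k : ℕ} (hk : 1 ≤ k) (hkn : k ≤ n) (ω : Path n) (j : ℕ) :
    (fun i => purgingStart k ω j i + (ω j).2 i - arrival ω j) =
      backward k j fun m => ω (if m ≤ j then j - m else m) := by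
  induction j with
  | zero => ext i; simp [backward, purgingStart]
  | succ j ih =>
    have h : backward k j (fun m => ω (if m + 1 ≤ j + 1 then j + 1 - (m + 1) else m + 1)) =
        backward k j fun m => ω (if m ≤ j then j - m else m) :=
      backward_congr j fun m hm => by simp [hm]
    rw [backward, h, ← ih]
    ext i
    have ha : arrival ω (j + 1) = arrival ω j + (ω (j + 1)).1 := Finset.sum_range_succ _ _
    have ho := orderStat_add_const hk hkn (fun m => purgingStart k ω j m + (ω j).2 m)
      (-arrival ω j)
    simp only [← sub_eq_add_neg] at ho
    simp only [purgingStep, purgingStart, ho, ha, Nat.zero_le, if_true, Nat.sub_zero]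
    rw [min_sub_sub_right, sub_sub, add_sub_right_comm, ← max_sub_sub_right, sub_self]

/-- The sojourn time when the input is read backwards in time. -/
def backwardSojourn {n : ℕ} (k j : ℕ) (ω : Path n) : ℝ := orderStat k (backward k j ω)

theorem measurable_backwardSojourn {n k : ℕ} (hk : 1 ≤ k) (hkn : k ≤ n) (j : ℕ) :
    Measurable (backwardSojourn k j : Path n → ℝ) :=
  (measurable_orderStat hk hkn).comp (measurable_backward hk hkn j)

theorem backwardSojourn_mono {n k : ℕ} (hk : 1 ≤ k) (hkn : k ≤ n) (ω : Path n) :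
    Monotone fun j => backwardSojourn k j ω :=
  fun _ _ h => orderStat_mono hk hkn (backward_mono hk hkn ω h)

theorem purgingSojourn_eq_backwardSojourn {n k : ℕ} (hk : 1 ≤ k) (hkn : k ≤ n) (j : ℕ)
    (ω : Path n) : purgingSojourn n k j ω =
      backwardSojourn k j fun m => ω (if m ≤ j then j - m else m) := by
  rw [backwardSojourn, ← purgingStart_add_sub_arrival hk hkn]
  simp only [sub_eq_add_neg]
  rw [orderStat_add_const hk hkn]
  rfl

theorem isProbabilityMeasure_inputLaw {lam : ℝ} (hlam : 0 < lam) (σ : Measure ℝ)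
    [IsProbabilityMeasure σ] (n : ℕ) : IsProbabilityMeasure (inputLaw lam σ n) := by
  have := isProbabilityMeasure_expMeasure hlam
  unfold inputLaw
  infer_instance

theorem measurePreserving_reindex {lam : ℝ} (hlam : 0 < lam) (σ : Measure ℝ)
    [IsProbabilityMeasure σ] (n : ℕ) {f : ℕ → ℕ} (hf : f.Injective) :
    MeasurePreserving (fun (ω : Path n) m => ω (f m)) (inputLaw lam σ n) (inputLaw lam σ n) := by
  have := isProbabilityMeasure_expMeasure hlam
  exact ⟨measurable_pi_lambda _ fun m => measurable_pi_apply _,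
    Measure.map_infinitePi_infinitePi_of_inj (P := fun _ : ℕ =>
      (expMeasure lam).prod (Measure.pi fun _ : Fin n => σ)) hf⟩

theorem purgingMean_eq_iSup {n k : ℕ} (hk : 1 ≤ k) (hkn : k ≤ n) {lam : ℝ} (hlam : 0 < lam)
    (σ : Measure ℝ) [IsProbabilityMeasure σ] :
    purgingMean lam σ n k =
      ⨆ j, ∫⁻ ω, ENNReal.ofReal (backwardSojourn k j ω) ∂inputLaw lam σ n := by
  have := isProbabilityMeasure_inputLaw hlam σ n
  refine stableMean_eq_iSup (fun j => ?_) (measurable_backwardSojourn hk hkn)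
    (backwardSojourn_mono hk hkn)
  have hf : Function.Injective fun m : ℕ => if m ≤ j then j - m else m := by
    intro a b h
    simp only at h
    split_ifs at h <;> omega
  have hmp := measurePreserving_reindex hlam σ n hf
  have h : purgingSojourn n k j = backwardSojourn k j ∘ fun ω m =>
      ω (if m ≤ j then j - m else m) :=
    funext fun ω => purgingSojourn_eq_backwardSojourn hk hkn j ω
  have hm := measurable_backwardSojourn hk hkn j
  rw [h]
  exact ⟨(hm.comp hmp.measurable).aemeasurable, hm.aemeasurable, by
    rw [← Measure.map_map hm hmp.measurable, hmp.map_eq]⟩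

theorem ae_inputLaw_nonneg {lam : ℝ} (hlam : 0 < lam) {σ : Measure ℝ}
    [IsProbabilityMeasure σ] (hσ : ∀ᵐ x ∂σ, 0 ≤ x) (n : ℕ) :
    ∀ᵐ ω ∂inputLaw lam σ n, ∀ m i, 0 ≤ (ω m).2 i := by
  have := isProbabilityMeasure_expMeasure hlam
  rw [ae_all_iff]
  refine fun m => ae_all_iff.2 fun i => ?_
  have h1 : MeasurePreserving (fun ω : Path n => ω m) (inputLaw lam σ n)
      ((expMeasure lam).prod (Measure.pi fun _ : Fin n => σ)) :=
    measurePreserving_eval_infinitePi _ m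
  have h2 := (measurePreserving_eval (fun _ : Fin n => σ) i).comp
    (measurePreserving_snd.comp h1)
  exact h2.quasiMeasurePreserving.ae hσ

/-! ### The basic queue as a purging queue -/

theorem min_orderStat_card {n : ℕ} (x : Fin n → ℝ) (i : Fin n) :
    min (x i) (orderStat n x) = x i :=
  min_eq_left (le_orderStat_card (Nat.one_le_of_lt i.2) x i)

theorem purgingStart_card {n : ℕ} (ω : Path n) (j : ℕ) :
    purgingStart n ω j = basicStart ω j := by
  induction j with
  | zero => rfl
  | succ j ih =>
    ext i
    rw [purgingStart, min_orderStat_card (fun m => purgingStart n ω j m + (ω j).2 m) i, ih,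
      basicStart]

theorem purgingMean_card (lam : ℝ) (σ : Measure ℝ) (n : ℕ) :
    purgingMean lam σ n n = basicMean lam σ n := by
  have : purgingSojourn n n = basicSojourn n := by
    ext j ω
    simp only [purgingSojourn, basicSojourn, purgingStart_card]
  rw [purgingMean, basicMean, this]

/-- Parameter `n` means no purging: the minimum with the departure time, which may shorten a delay
for `k`, has no effect there. -/
theorem backward_le_backward_card {n k : ℕ} (j : ℕ) (ω : Path n) :
    backward k j ω ≤ backward n j ω := by
  induction j generalizing ω with
  | zero => exact le_rfl
  | succ j ih =>
    intro i
    simp only [backward, purgingStep, min_orderStat_card]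
    gcongr
    exact (min_le_left _ _).trans (ih _ i)

/-- Restriction of the input to the nodes in the range of `e`. -/
def restrictNodes {n i : ℕ} (e : Fin i → Fin n) (ω : Path n) : Path i :=
  fun m => ((ω m).1, fun l => (ω m).2 (e l))

/-- Without purging each node depends only on the arrivals and its own service times. -/
theorem backward_restrictNodes {n i : ℕ} (e : Fin i → Fin n) (j : ℕ) (ω : Path n) (l : Fin i) :
    backward i j (restrictNodes e ω) l = backward n j ω (e l) := by
  induction j generalizing ω l with
  | zero => rfl
  | succ j ih =>
    simp only [backward, purgingStep, min_orderStat_card]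
    exact congrArg (fun z => max 0 (z - (ω 0).1) + (ω 0).2 (e l)) (ih (fun m => ω (m + 1)) l)

theorem measurePreserving_restrictNodes {lam : ℝ} (hlam : 0 < lam) (σ : Measure ℝ)
    [IsProbabilityMeasure σ] {n i : ℕ} {e : Fin i → Fin n} (he : e.Injective) :
    MeasurePreserving (restrictNodes e) (inputLaw lam σ n) (inputLaw lam σ i) := by
  have := isProbabilityMeasure_expMeasure hlam
  have h1 : Measurable fun (x : Fin n → ℝ) (l : Fin i) => x (e l) :=
    measurable_pi_lambda _ fun l => measurable_pi_apply _
  have h2 : (Measure.pi fun _ : Fin n => σ).map (fun x l => x (e l)) =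
      Measure.pi fun _ : Fin i => σ := by
    have := Measure.map_infinitePi_infinitePi_of_inj (P := fun _ : Fin n => σ) he
    rwa [Measure.infinitePi_eq_pi, Measure.infinitePi_eq_pi] at this
  have h3 : Measurable (Prod.map id (fun (x : Fin n → ℝ) (l : Fin i) => x (e l)) :
      ℝ × (Fin n → ℝ) → ℝ × (Fin i → ℝ)) := measurable_id.prodMap h1
  refine ⟨measurable_pi_lambda _ fun m => h3.comp (measurable_pi_apply m), ?_⟩
  have h4 := Measure.infinitePi_map_pi (fun _ : ℕ => (expMeasure lam).prod
    (Measure.pi fun _ : Fin n => σ)) (fun _ : ℕ => h3)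
  rw [← Measure.map_prod_map _ _ measurable_id h1, h2, Measure.map_id] at h4
  exact h4

theorem lintegral_maxOver_backward {lam : ℝ} (hlam : 0 < lam) (σ : Measure ℝ)
    [IsProbabilityMeasure σ] {n : ℕ} {S : Finset (Fin n)} (hS : 1 ≤ S.card) (j : ℕ) :
    ∫⁻ ω, ENNReal.ofReal (maxOver S (backward n j ω)) ∂inputLaw lam σ n =
      ∫⁻ ω, ENNReal.ofReal (backwardSojourn S.card j ω) ∂inputLaw lam σ S.card := by
  rw [← (measurePreserving_restrictNodes hlam σ (S.orderEmbOfFin rfl).injective).lintegral_comp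
    (measurable_backwardSojourn hS le_rfl j).ennreal_ofReal]
  simp only [backwardSojourn, maxOver]
  congr! 4 with ω
  ext m
  exact (backward_restrictNodes _ j ω m).symm

/-! ### The naive bound -/

theorem maxOver_nonneg {n : ℕ} {S : Finset (Fin n)} (hS : 1 ≤ S.card) {x : Fin n → ℝ}
    (hx : ∀ i, 0 ≤ x i) : 0 ≤ maxOver S x :=
  orderStat_nonneg hS le_rfl fun _ => hx _

theorem measurable_maxOver {n : ℕ} {S : Finset (Fin n)} (hS : 1 ≤ S.card) :
    Measurable (maxOver S) :=
  (measurable_orderStat hS le_rfl).comp (measurable_pi_lambda _ fun _ => measurable_pi_apply _)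

theorem basicMean_eq_iSup {n : ℕ} (hn : 1 ≤ n) {lam : ℝ} (hlam : 0 < lam)
    (σ : Measure ℝ) [IsProbabilityMeasure σ] :
    basicMean lam σ n =
      ⨆ j, ∫⁻ ω, ENNReal.ofReal (backwardSojourn n j ω) ∂inputLaw lam σ n := by
  rw [← purgingMean_card, purgingMean_eq_iSup hn le_rfl hlam]

/-- The weights have signs, so the maxima must be integrable before integrating term by term;
finiteness of the basic means provides this for every `j`. -/
theorem integral_orderStat_backward_card {n k : ℕ} (hk : 1 ≤ k) (hkn : k ≤ n) {lam : ℝ}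
    (hlam : 0 < lam) {σ : Measure ℝ} [IsProbabilityMeasure σ] (hσ : ∀ᵐ x ∂σ, 0 ≤ x)
    (hfin : ∀ i ∈ Finset.Icc k n, basicMean lam σ i ≠ ⊤) (j : ℕ) :
    Integrable (fun ω => orderStat k (backward n j ω)) (inputLaw lam σ n) ∧
    ∫ ω, orderStat k (backward n j ω) ∂inputLaw lam σ n =
      ∑ i ∈ Finset.Icc k n, (coeffW n k i : ℝ) *
        (∫⁻ ω, ENNReal.ofReal (backwardSojourn i j ω) ∂inputLaw lam σ i).toReal := by
  have hn : 1 ≤ n := hk.trans hkn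
  have hnn := ae_inputLaw_nonneg hlam hσ n
  have hcard : ∀ i ∈ Finset.Icc k n, ∀ S ∈ Finset.powersetCard i (Finset.univ : Finset (Fin n)),
      1 ≤ S.card := fun i hi S hS => by
    rw [(Finset.mem_powersetCard.1 hS).2]; exact hk.trans (Finset.mem_Icc.1 hi).1
  have hlt : ∀ i ∈ Finset.Icc k n,
      ∫⁻ ω, ENNReal.ofReal (backwardSojourn i j ω) ∂inputLaw lam σ i ≠ ⊤ := fun i hi => by
    have h := hfin i hi
    rw [basicMean_eq_iSup (hk.trans (Finset.mem_Icc.1 hi).1) hlam] at h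
    exact ne_top_of_le_ne_top h (le_iSup (fun j =>
      ∫⁻ ω, ENNReal.ofReal (backwardSojourn i j ω) ∂inputLaw lam σ i) j)
  have hmeas : ∀ i ∈ Finset.Icc k n, ∀ S ∈ Finset.powersetCard i (Finset.univ : Finset (Fin n)),
      Measurable fun ω => maxOver S (backward n j ω) := fun i hi S hS =>
    (measurable_maxOver (hcard i hi S hS)).comp (measurable_backward hn le_rfl j)
  have hnonneg : ∀ i ∈ Finset.Icc k n,
      ∀ S ∈ Finset.powersetCard i (Finset.univ : Finset (Fin n)),
      0 ≤ᵐ[inputLaw lam σ n] fun ω => maxOver S (backward n j ω) := fun i hi S hS => by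
    filter_upwards [hnn] with ω hω
    exact maxOver_nonneg (hcard i hi S hS) (backward_nonneg j hω)
  have hval : ∀ i ∈ Finset.Icc k n, ∀ S ∈ Finset.powersetCard i (Finset.univ : Finset (Fin n)),
      ∫⁻ ω, ENNReal.ofReal (maxOver S (backward n j ω)) ∂inputLaw lam σ n =
      ∫⁻ ω, ENNReal.ofReal (backwardSojourn i j ω) ∂inputLaw lam σ i := fun i hi S hS => by
    have h1 := (Finset.mem_powersetCard.1 hS).2
    have h2 := lintegral_maxOver_backward hlam σ (hcard i hi S hS) j
    subst h1
    exact h2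
  have hint : ∀ i ∈ Finset.Icc k n, ∀ S ∈ Finset.powersetCard i (Finset.univ : Finset (Fin n)),
      Integrable (fun ω => maxOver S (backward n j ω)) (inputLaw lam σ n) := fun i hi S hS =>
    (lintegral_ofReal_ne_top_iff_integrable (hmeas i hi S hS).aestronglyMeasurable
      (hnonneg i hi S hS)).1 (hval i hi S hS ▸ hlt i hi)
  have hint2 : ∀ i ∈ Finset.Icc k n, Integrable (fun ω => (maxCoeff k i : ℝ) *
      ∑ S ∈ Finset.powersetCard i Finset.univ, maxOver S (backward n j ω))
      (inputLaw lam σ n) :=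
    fun i hi => (integrable_finsetSum _ (hint i hi)).const_mul _
  have hae : (fun ω => orderStat k (backward n j ω)) =ᵐ[inputLaw lam σ n] fun ω =>
      ∑ i ∈ Finset.Icc k n, (maxCoeff k i : ℝ) *
        ∑ S ∈ Finset.powersetCard i Finset.univ, maxOver S (backward n j ω) := by
    filter_upwards [hnn] with ω hω
    exact orderStat_eq_sum_maxOver hk hkn (backward_nonneg j hω)
  refine ⟨(integrable_finsetSum _ hint2).congr hae.symm, ?_⟩
  rw [integral_congr_ae hae, integral_finsetSum _ hint2]
  refine Finset.sum_congr rfl fun i hi => ?_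
  rw [integral_const_mul, integral_finsetSum _ (hint i hi), Finset.sum_congr rfl fun S hS => by
    rw [integral_eq_lintegral_of_nonneg_ae (hnonneg i hi S hS)
      (hmeas i hi S hS).aestronglyMeasurable, hval i hi S hS],
    Finset.sum_const, Finset.card_powersetCard, Finset.card_univ, Fintype.card_fin,
    coeffW_eq (Finset.mem_Icc.1 hi).2, nsmul_eq_mul]
  push_cast
  ring

theorem purgingMean_le_naiveBound {n k : ℕ} (hk : 1 ≤ k) (hkn : k ≤ n) {lam : ℝ}
    (hlam : 0 < lam) {σ : Measure ℝ} [IsProbabilityMeasure σ] (hσ : ∀ᵐ x ∂σ, 0 ≤ x) :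
    (purgingMean lam σ n k : EReal) ≤ naiveBound lam σ n k := by
  unfold naiveBound
  split_ifs with hfin
  swap
  · exact le_top
  have hn : 1 ≤ n := hk.trans hkn
  have hnn := ae_inputLaw_nonneg hlam hσ n
  have key := integral_orderStat_backward_card hk hkn hlam hσ hfin
  set B : ℝ := ∑ i ∈ Finset.Icc k n, (coeffW n k i : ℝ) * (basicMean lam σ i).toReal with hB
  have hmono : Monotone fun j => ∫ ω, orderStat k (backward n j ω) ∂inputLaw lam σ n :=
    fun a b h => integral_mono (key a).1 (key b).1 fun ω =>
      orderStat_mono hk hkn (backward_mono hn le_rfl ω h)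
  have hlim : Tendsto (fun j => ∫ ω, orderStat k (backward n j ω) ∂inputLaw lam σ n)
      atTop (𝓝 B) := by
    simp only [fun j => (key j).2]
    refine tendsto_finsetSum _ fun i hi => Tendsto.const_mul _ ?_
    have hi1 : 1 ≤ i := hk.trans (Finset.mem_Icc.1 hi).1
    refine (ENNReal.tendsto_toReal (hfin i hi)).comp ?_
    rw [basicMean_eq_iSup hi1 hlam]
    exact tendsto_atTop_iSup fun a b h => lintegral_mono fun ω =>
      ENNReal.ofReal_le_ofReal (backwardSojourn_mono hi1 le_rfl ω h)
  have hnonneg : ∀ j, 0 ≤ᵐ[inputLaw lam σ n] fun ω => orderStat k (backward n j ω) := by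
    intro j
    filter_upwards [hnn] with ω hω
    exact orderStat_nonneg hk hkn (backward_nonneg j hω)
  -- Not visible from the signed sum; needed so that `ENNReal.ofReal B` does not truncate.
  have hB0 : 0 ≤ B := ge_of_tendsto' hlim fun j => integral_nonneg_of_ae (hnonneg j)
  have hle : purgingMean lam σ n k ≤ ENNReal.ofReal B := by
    rw [purgingMean_eq_iSup hk hkn hlam]
    refine iSup_le fun j => ?_
    calc ∫⁻ ω, ENNReal.ofReal (backwardSojourn k j ω) ∂inputLaw lam σ n
        ≤ ∫⁻ ω, ENNReal.ofReal (orderStat k (backward n j ω)) ∂inputLaw lam σ n :=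
          lintegral_mono fun ω => ENNReal.ofReal_le_ofReal
            (orderStat_mono hk hkn (backward_le_backward_card j ω))
      _ = ENNReal.ofReal (∫ ω, orderStat k (backward n j ω) ∂inputLaw lam σ n) :=
          (ofReal_integral_eq_lintegral_ofReal (key j).1 (hnonneg j)).symm
      _ ≤ ENNReal.ofReal B := ENNReal.ofReal_le_ofReal (hmono.ge_of_tendsto hlim j)
  calc (purgingMean lam σ n k : EReal) ≤ ((ENNReal.ofReal B : ℝ≥0∞) : EReal) :=
        EReal.coe_ennreal_le_coe_ennreal_iff.2 hle
    _ = (B : EReal) := by rw [EReal.coe_ennreal_ofReal, max_eq_left hB0]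

/-! ### The first job and the subsequent jobs are independent -/

/-- The inverse map `cons` is checked on finite-dimensional boxes, where the coordinate `0` splits
off as a factor. -/
theorem measurePreserving_head_tail {X : Type*} [MeasurableSpace X] (μ : Measure X)
    [IsProbabilityMeasure μ] :
    MeasurePreserving (fun ω : ℕ → X => (ω 0, fun m => ω (m + 1)))
      (Measure.infinitePi fun _ : ℕ => μ) (μ.prod (Measure.infinitePi fun _ : ℕ => μ)) := by
  let cons : X × (ℕ → X) → ℕ → X := fun p m => Nat.casesOn m p.1 p.2
  have hcons : Measurable cons := measurable_pi_lambda _ fun m => by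
    cases m with
    | zero => exact measurable_fst
    | succ m => exact (measurable_pi_apply m).comp measurable_snd
  have hht : Measurable fun ω : ℕ → X => (ω 0, fun m => ω (m + 1)) :=
    (measurable_pi_apply 0).prodMk (measurable_pi_lambda _ fun m => measurable_pi_apply _)
  have h : (μ.prod (Measure.infinitePi fun _ : ℕ => μ)).map cons =
      Measure.infinitePi fun _ : ℕ => μ := by
    refine Measure.eq_infinitePi _ fun s t ht => ?_
    have hpre : cons ⁻¹' (Set.pi s t) = (if 0 ∈ s then t 0 else Set.univ) ×ˢ
        Set.pi (s.preimage Nat.succ Nat.succ_injective.injOn) (fun m => t (m + 1)) := by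
      ext ⟨x, ω⟩
      simp only [Set.mem_preimage, Set.mem_pi, Finset.mem_coe, Set.mem_prod, Finset.mem_preimage]
      constructor
      · refine fun h => ⟨?_, fun m hm => h (m + 1) hm⟩
        split_ifs with h0
        · exact h 0 h0
        · trivial
      · rintro ⟨h1, h2⟩ m hm
        cases m with
        | zero => rwa [if_pos hm] at h1
        | succ m => exact h2 m hm
    rw [Measure.map_apply hcons (MeasurableSet.pi s.countable_toSet fun m _ => ht m), hpre,
      Measure.prod_prod, Measure.infinitePi_pi _ fun m _ => ht (m + 1)]
    have hs : ∏ m ∈ s.preimage Nat.succ Nat.succ_injective.injOn, μ (t (m + 1)) =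
        ∏ m ∈ s.erase 0, μ (t m) := by
      refine Finset.prod_nbij Nat.succ ?_ Nat.succ_injective.injOn ?_ fun _ _ => rfl
      · intro m hm
        simpa using hm
      · intro m hm
        obtain ⟨h0, hm⟩ := Finset.mem_erase.1 (Finset.mem_coe.1 hm)
        obtain ⟨l, rfl⟩ := Nat.exists_eq_succ_of_ne_zero h0
        exact ⟨l, by simpa using hm, rfl⟩
    rw [hs]
    split_ifs with h0
    · exact Finset.mul_prod_erase s (fun m => μ (t m)) h0
    · rw [measure_univ, one_mul, Finset.erase_eq_of_notMem h0]
  refine ⟨hht, ?_⟩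
  conv_lhs => rw [← h]
  rw [Measure.map_map hht hcons]
  exact Measure.map_id

/-! ### An identity for the exponential distribution -/

/-- On `[0, y]` the integrand times the density is the derivative of `-(y - t)² exp(-λt)`, which is
`-y²` at `0` and vanishes at `y`. This links the second moment of a sojourn time to the first two
moments of the next wait. -/
theorem lintegral_expMeasure_sub {lam y : ℝ} (hlam : 0 < lam) (hy : 0 ≤ y) :
    ∫⁻ t, (ENNReal.ofReal (y - t) ^ 2 + ENNReal.ofReal (2 / lam) * ENNReal.ofReal (y - t))
      ∂expMeasure lam = ENNReal.ofReal y ^ 2 := by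
  let g : ℝ → ℝ := fun t => 2 * (y - t) * Real.exp (-(lam * t)) +
    lam * (y - t) ^ 2 * Real.exp (-(lam * t))
  have hg : Continuous g := by fun_prop
  have hF : ∀ t, HasDerivAt (fun t => -((y - t) ^ 2 * Real.exp (-(lam * t)))) (g t) t := by
    intro t
    have h1 : HasDerivAt (fun t => (y - t) ^ 2) (2 * (y - t) * -1) t := by
      simpa using ((hasDerivAt_id t).const_sub y).fun_pow 2
    have h2 : HasDerivAt (fun t => Real.exp (-(lam * t))) (Real.exp (-(lam * t)) * -lam) t := by
      simpa using ((hasDerivAt_id t).const_mul lam).neg.exp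
    exact (h1.fun_mul h2).fun_neg.congr_deriv (by simp only [g]; ring)
  have hi : ∫ t in (0)..y, g t = y ^ 2 := by
    rw [intervalIntegral.integral_eq_sub_of_hasDerivAt (fun t _ => hF t)
      (hg.intervalIntegrable _ _)]
    simp
  have hexp : expMeasure lam = volume.withDensity (exponentialPDF lam) := rfl
  have hpdf : Measurable (exponentialPDF lam) :=
    (measurable_exponentialPDFReal lam).ennreal_ofReal
  have hind : ∀ t, exponentialPDF lam t *
      (ENNReal.ofReal (y - t) ^ 2 + ENNReal.ofReal (2 / lam) * ENNReal.ofReal (y - t)) =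
      (Set.Icc 0 y).indicator (fun t => ENNReal.ofReal (g t)) t := by
    intro t
    by_cases ht : t ∈ Set.Icc 0 y
    · have h1 : 0 ≤ y - t := sub_nonneg.2 ht.2
      rw [Set.indicator_of_mem ht, exponentialPDF_of_nonneg ht.1, ← ENNReal.ofReal_pow h1,
        ← ENNReal.ofReal_mul (by positivity), ← ENNReal.ofReal_add (by positivity) (by positivity),
        ← ENNReal.ofReal_mul (by positivity)]
      congr 1
      simp only [g]
      field_simp
      ring
    · rw [Set.indicator_of_notMem ht]
      rcases lt_or_ge t 0 with h | h
      · rw [exponentialPDF_of_neg h, zero_mul]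
      · have : y - t ≤ 0 := by
          by_contra h'
          exact ht ⟨h, by linarith⟩
        simp [ENNReal.ofReal_of_nonpos this]
  rw [hexp, lintegral_withDensity_eq_lintegral_mul _ hpdf (by fun_prop)]
  simp only [Pi.mul_apply, hind]
  rw [lintegral_indicator measurableSet_Icc, ← ofReal_integral_eq_lintegral_ofReal
      (hg.integrableOn_Icc)
      ((ae_restrict_iff' measurableSet_Icc).2 (Eventually.of_forall fun t ht => ?_)),
    integral_Icc_eq_integral_Ioc, ← intervalIntegral.integral_of_le hy, hi, ENNReal.ofReal_pow hy]
  have h1 : 0 ≤ y - t := sub_nonneg.2 ht.2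
  simp only [g, Pi.zero_apply]
  positivity

/-! ### The split-merge queue -/

/-- The sojourn time in the split-merge queue (a single-server queue with the `k`-th order
statistics as service times) when the input is read backwards in time. -/
def splitMerge {n : ℕ} (k : ℕ) : ℕ → Path n → ℝ
  | 0, ω => orderStat k (ω 0).2
  | j + 1, ω => max 0 (splitMerge k j (fun m => ω (m + 1)) - (ω 0).1) + orderStat k (ω 0).2

theorem splitMerge_mono {n : ℕ} (k : ℕ) (ω : Path n) : Monotone fun j => splitMerge k j ω := by
  refine monotone_nat_of_le_succ fun j => ?_
  induction j generalizing ω with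
  | zero => exact le_add_of_nonneg_left (le_max_left _ _)
  | succ j ih =>
    simp only [splitMerge] at ih ⊢
    gcongr
    exact ih _

/-- Each node is released no later than the departure of the previous job. Replacing all waits by
the common wait for that departure turns the order statistic into wait plus order statistic of the
services. -/
theorem backwardSojourn_le_splitMerge {n k : ℕ} (hk : 1 ≤ k) (hkn : k ≤ n) (j : ℕ)
    (ω : Path n) : backwardSojourn k j ω ≤ splitMerge k j ω := by
  induction j generalizing ω with
  | zero => exact le_rfl
  | succ j ih =>
    have h := ih fun m => ω (m + 1)
    unfold backwardSojourn at h ⊢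
    rw [splitMerge, add_comm (max _ _), ← orderStat_add_const hk hkn, backward]
    refine orderStat_mono hk hkn fun i => ?_
    simp only [purgingStep]
    rw [add_comm]
    gcongr
    exact (min_le_right _ _).trans h

theorem splitMerge_nonneg {n k : ℕ} (hk : 1 ≤ k) (hkn : k ≤ n) (j : ℕ) {ω : Path n}
    (h : ∀ m i, 0 ≤ (ω m).2 i) : 0 ≤ splitMerge k j ω := by
  cases j with
  | zero => exact orderStat_nonneg hk hkn (h 0)
  | succ j => exact add_nonneg (le_max_left _ _) (orderStat_nonneg hk hkn (h 0))

theorem measurable_splitMerge {n k : ℕ} (hk : 1 ≤ k) (hkn : k ≤ n) (j : ℕ) :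
    Measurable (splitMerge k j : Path n → ℝ) := by
  have hS : Measurable fun ω : Path n => orderStat k (ω 0).2 :=
    (measurable_orderStat hk hkn).comp (measurable_pi_apply 0).snd
  induction j with
  | zero => exact hS
  | succ j ih =>
    have h : Measurable fun ω : Path n => splitMerge k j fun m => ω (m + 1) :=
      ih.comp (measurable_pi_lambda _ fun m => measurable_pi_apply (m + 1))
    exact (measurable_const.max (h.sub (measurable_pi_apply 0).fst)).add hS

/-- The `p`-th moment of the waiting time of job `j + 1` in the split-merge queue. -/
def waitMoment (lam : ℝ) (σ : Measure ℝ) (n k j p : ℕ) : ℝ≥0∞ :=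
  ∫⁻ ω, ∫⁻ t, ENNReal.ofReal (splitMerge k j ω - t) ^ p ∂expMeasure lam ∂inputLaw lam σ n

theorem waitMoment_mono {lam : ℝ} (σ : Measure ℝ) (n k j p : ℕ) :
    waitMoment lam σ n k j p ≤ waitMoment lam σ n k (j + 1) p :=
  lintegral_mono fun ω => lintegral_mono fun t => pow_le_pow_left'
    (ENNReal.ofReal_le_ofReal (sub_le_sub_right (splitMerge_mono k ω j.le_succ) t)) p

theorem measurable_sub_splitMerge {lam : ℝ} (hlam : 0 < lam) {n k : ℕ} (hk : 1 ≤ k)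
    (hkn : k ≤ n) (j p : ℕ) : Measurable fun ω : Path n =>
      ∫⁻ t, ENNReal.ofReal (splitMerge k j ω - t) ^ p ∂expMeasure lam := by
  have := isProbabilityMeasure_expMeasure hlam
  exact Measurable.lintegral_prod_right' (f := fun q : Path n × ℝ =>
    ENNReal.ofReal (splitMerge k j q.1 - q.2) ^ p)
    ((((measurable_splitMerge hk hkn j).comp measurable_fst).sub
      measurable_snd).ennreal_ofReal.pow_const p)

theorem waitMoment_two_add {n k : ℕ} (hk : 1 ≤ k) (hkn : k ≤ n) {lam : ℝ} (hlam : 0 < lam)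
    {σ : Measure ℝ} [IsProbabilityMeasure σ] (hσ : ∀ᵐ x ∂σ, 0 ≤ x) (j : ℕ) :
    waitMoment lam σ n k j 2 + ENNReal.ofReal (2 / lam) * waitMoment lam σ n k j 1 =
      ∫⁻ ω, ENNReal.ofReal (splitMerge k j ω) ^ 2 ∂inputLaw lam σ n := by
  have := isProbabilityMeasure_expMeasure hlam
  rw [waitMoment, waitMoment,
    ← lintegral_const_mul _ (measurable_sub_splitMerge hlam hk hkn j 1),
    ← lintegral_add_left (measurable_sub_splitMerge hlam hk hkn j 2)]
  refine lintegral_congr_ae ?_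
  filter_upwards [ae_inputLaw_nonneg hlam hσ n] with ω hω
  rw [← lintegral_expMeasure_sub hlam (splitMerge_nonneg hk hkn j hω),
    lintegral_add_left (by fun_prop), lintegral_const_mul _ (by fun_prop)]
  simp only [pow_one]

theorem ae_orderStat_nonneg {n k : ℕ} (hk : 1 ≤ k) (hkn : k ≤ n) {σ : Measure ℝ}
    [IsProbabilityMeasure σ] (hσ : ∀ᵐ x ∂σ, 0 ≤ x) :
    ∀ᵐ x ∂Measure.pi fun _ : Fin n => σ, 0 ≤ orderStat k x := by
  have h : ∀ᵐ x ∂Measure.pi fun _ : Fin n => σ, ∀ i, 0 ≤ x i := ae_all_iff.2 fun i =>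
    (measurePreserving_eval (fun _ : Fin n => σ) i).quasiMeasurePreserving.ae hσ
  filter_upwards [h] with x hx
  exact orderStat_nonneg hk hkn hx

theorem lintegral_splitMerge_succ {n k : ℕ} (hk : 1 ≤ k) (hkn : k ≤ n) {lam : ℝ}
    (hlam : 0 < lam) {σ : Measure ℝ} [IsProbabilityMeasure σ] (hσ : ∀ᵐ x ∂σ, 0 ≤ x)
    (j p : ℕ) :
    ∫⁻ ω, ENNReal.ofReal (splitMerge k (j + 1) ω) ^ p ∂inputLaw lam σ n =
      ∫⁻ ω, ∫⁻ t, ∫⁻ x, (ENNReal.ofReal (splitMerge k j ω - t) +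
        ENNReal.ofReal (orderStat k x)) ^ p ∂(Measure.pi fun _ : Fin n => σ)
        ∂expMeasure lam ∂inputLaw lam σ n := by
  have := isProbabilityMeasure_expMeasure hlam
  have := isProbabilityMeasure_inputLaw hlam σ n
  let F : (ℝ × (Fin n → ℝ)) × Path n → ℝ≥0∞ := fun q =>
    ENNReal.ofReal (max 0 (splitMerge k j q.2 - q.1.1) + orderStat k q.1.2) ^ p
  have hF : Measurable F := ((measurable_const.max (((measurable_splitMerge hk hkn j).comp
    measurable_snd).sub measurable_fst.fst)).add ((measurable_orderStat hk hkn).comp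
      measurable_fst.snd)).ennreal_ofReal.pow_const p
  have h1 : ∫⁻ ω, ENNReal.ofReal (splitMerge k (j + 1) ω) ^ p ∂inputLaw lam σ n =
      ∫⁻ q, F q ∂((expMeasure lam).prod (Measure.pi fun _ : Fin n => σ)).prod
        (inputLaw lam σ n) :=
    (measurePreserving_head_tail _).lintegral_comp hF
  rw [h1, lintegral_prod_symm _ hF.aemeasurable]
  refine lintegral_congr fun ω => ?_
  rw [lintegral_prod (fun p => F (p, ω)) (hF.comp measurable_prodMk_right).aemeasurable]
  refine lintegral_congr fun t => lintegral_congr_ae ?_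
  filter_upwards [ae_orderStat_nonneg hk hkn hσ] with x hx
  simp only [F]
  rw [ENNReal.ofReal_add (le_max_left _ _) hx, ENNReal.ofReal_max, ENNReal.ofReal_zero,
    max_eq_right (zero_le)]

theorem lintegral_splitMerge_succ_one {n k : ℕ} (hk : 1 ≤ k) (hkn : k ≤ n) {lam : ℝ}
    (hlam : 0 < lam) {σ : Measure ℝ} [IsProbabilityMeasure σ] (hσ : ∀ᵐ x ∂σ, 0 ≤ x) (j : ℕ) :
    ∫⁻ ω, ENNReal.ofReal (splitMerge k (j + 1) ω) ∂inputLaw lam σ n =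
      waitMoment lam σ n k j 1 + orderStatMoment σ n k 1 := by
  have := isProbabilityMeasure_expMeasure hlam
  have := isProbabilityMeasure_inputLaw hlam σ n
  have h := lintegral_splitMerge_succ hk hkn hlam hσ j 1
  simp only [pow_one] at h
  rw [h, waitMoment, orderStatMoment]
  simp only [pow_one, lintegral_add_left measurable_const, lintegral_const, measure_univ, mul_one]
  have hm := measurable_sub_splitMerge (lam := lam) hlam hk hkn j 1
  simp only [pow_one] at hm
  have h2 : ∀ ω : Path n, ∫⁻ t, (ENNReal.ofReal (splitMerge k j ω - t) +
      ∫⁻ x, ENNReal.ofReal (orderStat k x) ∂(Measure.pi fun _ : Fin n => σ)) ∂expMeasure lam =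
      (∫⁻ t, ENNReal.ofReal (splitMerge k j ω - t) ∂expMeasure lam) +
      ∫⁻ x, ENNReal.ofReal (orderStat k x) ∂(Measure.pi fun _ : Fin n => σ) := fun ω => by
    rw [lintegral_add_left (by fun_prop), lintegral_const, measure_univ, mul_one]
  simp only [h2]
  rw [lintegral_add_left hm, lintegral_const, measure_univ, mul_one]

theorem lintegral_splitMerge_succ_two {n k : ℕ} (hk : 1 ≤ k) (hkn : k ≤ n) {lam : ℝ}
    (hlam : 0 < lam) {σ : Measure ℝ} [IsProbabilityMeasure σ] (hσ : ∀ᵐ x ∂σ, 0 ≤ x) (j : ℕ) :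
    ∫⁻ ω, ENNReal.ofReal (splitMerge k (j + 1) ω) ^ 2 ∂inputLaw lam σ n =
      waitMoment lam σ n k j 2 +
        2 * waitMoment lam σ n k j 1 * orderStatMoment σ n k 1 + orderStatMoment σ n k 2 := by
  have := isProbabilityMeasure_expMeasure hlam
  have := isProbabilityMeasure_inputLaw hlam σ n
  have hS : Measurable fun x : Fin n → ℝ => ENNReal.ofReal (orderStat k x) :=
    (measurable_orderStat hk hkn).ennreal_ofReal
  have h1 : ∀ a : ℝ≥0∞, ∫⁻ x, (a + ENNReal.ofReal (orderStat k x)) ^ 2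
      ∂(Measure.pi fun _ : Fin n => σ) =
      a ^ 2 + (2 * orderStatMoment σ n k 1 * a ^ 1 + orderStatMoment σ n k 2) := by
    intro a
    have h : ∀ x : Fin n → ℝ, (a + ENNReal.ofReal (orderStat k x)) ^ 2 =
        a ^ 2 + (2 * a * ENNReal.ofReal (orderStat k x) ^ 1 +
          ENNReal.ofReal (orderStat k x) ^ 2) := fun x => by ring
    simp only [h]
    rw [lintegral_add_left measurable_const, lintegral_const, measure_univ, mul_one,
      lintegral_add_left ((hS.pow_const 1).const_mul _), lintegral_const_mul _ (hS.pow_const 1),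
      orderStatMoment, orderStatMoment]
    ring
  rw [lintegral_splitMerge_succ hk hkn hlam hσ]
  simp only [h1]
  have h2 : ∀ ω : Path n, ∫⁻ t, (ENNReal.ofReal (splitMerge k j ω - t) ^ 2 +
      (2 * orderStatMoment σ n k 1 * ENNReal.ofReal (splitMerge k j ω - t) ^ 1 +
        orderStatMoment σ n k 2)) ∂expMeasure lam =
      (∫⁻ t, ENNReal.ofReal (splitMerge k j ω - t) ^ 2 ∂expMeasure lam) +
      (2 * orderStatMoment σ n k 1 *
        (∫⁻ t, ENNReal.ofReal (splitMerge k j ω - t) ^ 1 ∂expMeasure lam) +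
        orderStatMoment σ n k 2) := fun ω => by
    rw [lintegral_add_left (by fun_prop), lintegral_add_left (by fun_prop),
      lintegral_const_mul _ (by fun_prop), lintegral_const, measure_univ, mul_one]
  simp only [h2]
  have hm := measurable_sub_splitMerge (lam := lam) hlam (n := n) hk hkn j
  rw [lintegral_add_left (hm 2), lintegral_add_left ((hm 1).const_mul _),
    lintegral_const_mul _ (hm 1), lintegral_const, measure_univ, mul_one, waitMoment, waitMoment]
  ring

/-- A finite second moment of one sojourn time bounds both moments of the next wait, which in turn
bound the next sojourn time. Finiteness permits the cancellation in `waitMoment_one_le`. -/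
theorem lintegral_splitMerge_sq_ne_top {n k : ℕ} (hk : 1 ≤ k) (hkn : k ≤ n) {lam : ℝ}
    (hlam : 0 < lam) {σ : Measure ℝ} [IsProbabilityMeasure σ] (hσ : ∀ᵐ x ∂σ, 0 ≤ x)
    (h1 : orderStatMoment σ n k 1 ≠ ⊤) (h2 : orderStatMoment σ n k 2 ≠ ⊤) (j : ℕ) :
    ∫⁻ ω, ENNReal.ofReal (splitMerge k j ω) ^ 2 ∂inputLaw lam σ n ≠ ⊤ := by
  have := isProbabilityMeasure_expMeasure hlam
  induction j with
  | zero =>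
    have hS : Measurable fun x : Fin n → ℝ => ENNReal.ofReal (orderStat k x) ^ 2 :=
      (measurable_orderStat hk hkn).ennreal_ofReal.pow_const 2
    have he : MeasurePreserving (fun ω : Path n => (ω 0).2) (inputLaw lam σ n)
        (Measure.pi fun _ : Fin n => σ) :=
      measurePreserving_snd.comp (measurePreserving_eval_infinitePi (fun _ : ℕ =>
        (expMeasure lam).prod (Measure.pi fun _ : Fin n => σ)) 0)
    exact (he.lintegral_comp hS).trans_ne h2
  | succ j ih =>
    rw [← waitMoment_two_add hk hkn hlam hσ, ENNReal.add_ne_top] at ih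
    have hl : ENNReal.ofReal (2 / lam) ≠ 0 := by simpa using by positivity
    have hw : waitMoment lam σ n k j 1 ≠ ⊤ := fun h => by
      rw [h, ENNReal.mul_top hl] at ih; exact ih.2 rfl
    rw [lintegral_splitMerge_succ_two hk hkn hlam hσ]
    exact ENNReal.add_ne_top.2 ⟨ENNReal.add_ne_top.2 ⟨ih.1, ENNReal.mul_ne_top
      (ENNReal.mul_ne_top ENNReal.ofNat_ne_top hw) h1⟩, h2⟩

/-- Let `a, b` and `a', b'` be the first and second moments of consecutive waits, and `s, q` those
of the service. Two expressions for the second moment of the sojourn time in between give `b' +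
(2/λ) a' = b + 2as + q`. Since `a ≤ a'` and `b ≤ b'`, this gives `(2/λ) a' ≤ 2a's + q`, which is
solved for `a'` using `λs < 1`. -/
theorem waitMoment_one_le {n k : ℕ} (hk : 1 ≤ k) (hkn : k ≤ n) {lam : ℝ}
    (hlam : 0 < lam) {σ : Measure ℝ} [IsProbabilityMeasure σ] (hσ : ∀ᵐ x ∂σ, 0 ≤ x)
    (h1 : ENNReal.ofReal lam * orderStatMoment σ n k 1 < 1)
    (h2 : orderStatMoment σ n k 2 ≠ ⊤) (j : ℕ) :
    waitMoment lam σ n k j 1 ≤ ENNReal.ofReal lam * orderStatMoment σ n k 2 /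
      (2 * (1 - ENNReal.ofReal lam * orderStatMoment σ n k 1)) := by
  have hl0 : ENNReal.ofReal lam ≠ 0 := by simpa using hlam
  have h1t : orderStatMoment σ n k 1 ≠ ⊤ := fun h => by
    rw [h, ENNReal.mul_top hl0] at h1; exact not_top_lt h1
  have hwt : ∀ j, waitMoment lam σ n k j 2 ≠ ⊤ ∧ waitMoment lam σ n k j 1 ≠ ⊤ := fun j => by
    have ih := lintegral_splitMerge_sq_ne_top hk hkn hlam hσ h1t h2 j
    rw [← waitMoment_two_add hk hkn hlam hσ, ENNReal.add_ne_top] at ih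
    refine ⟨ih.1, fun h => ?_⟩
    rw [h, ENNReal.mul_top (by simpa using by positivity)] at ih
    exact ih.2 rfl
  -- The recursion bounds the later of two consecutive waits.
  refine (waitMoment_mono σ n k j 1).trans ?_
  have hrec := waitMoment_two_add hk hkn hlam hσ (j + 1)
  rw [lintegral_splitMerge_succ_two hk hkn hlam hσ] at hrec
  have hm1 := waitMoment_mono (lam := lam) σ n k j 1
  have hm2 := waitMoment_mono (lam := lam) σ n k j 2
  obtain ⟨a, ha⟩ := ENNReal.canLift.prf _ (hwt j).2
  obtain ⟨b, hb⟩ := ENNReal.canLift.prf _ (hwt j).1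
  obtain ⟨a', ha'⟩ := ENNReal.canLift.prf _ (hwt (j + 1)).2
  obtain ⟨b', hb'⟩ := ENNReal.canLift.prf _ (hwt (j + 1)).1
  obtain ⟨s, hs⟩ := ENNReal.canLift.prf _ h1t
  obtain ⟨q, hq⟩ := ENNReal.canLift.prf _ h2
  lift lam to NNReal using hlam.le
  rw [← ha, ← ha'] at hm1
  rw [← hb, ← hb'] at hm2
  rw [← ha, ← hb, ← ha', ← hb', ← hs, ← hq] at hrec
  rw [← hs] at h1
  rw [← ha', ← hs, ← hq]
  have hlam' : 0 < lam := by exact_mod_cast hlam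
  have h2l : ENNReal.ofReal (2 / (lam : ℝ)) = ((2 / lam : NNReal) : ℝ≥0∞) := by
    rw [← ENNReal.ofReal_coe_nnreal]; norm_cast
  rw [ENNReal.ofReal_coe_nnreal] at h1 ⊢
  rw [h2l] at hrec
  norm_cast at h1 hm1 hm2 hrec
  have hpos : 0 < 1 - lam * s := tsub_pos_of_lt h1
  rw [ENNReal.le_div_iff_mul_le (Or.inl (by
    exact_mod_cast mul_ne_zero two_ne_zero hpos.ne')) (Or.inl (by
    norm_cast; exact ENNReal.coe_ne_top))]
  norm_cast
  rw [← NNReal.coe_le_coe]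
  have h1' : (lam : ℝ) * s < 1 := by exact_mod_cast h1
  have hm1' : (a : ℝ) ≤ a' := by exact_mod_cast hm1
  have hm2' : (b : ℝ) ≤ b' := by exact_mod_cast hm2
  have hrec' : (b' : ℝ) + 2 / lam * a' = b + 2 * a * s + q := by exact_mod_cast hrec
  have hlamR : (0 : ℝ) < lam := by exact_mod_cast hlam'
  push_cast [NNReal.coe_sub h1.le]
  have h5 : 2 / (lam : ℝ) * a' ≤ 2 * a' * s + q := by
    have : (a : ℝ) * s ≤ a' * s := mul_le_mul_of_nonneg_right hm1' s.2
    linarith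
  have h6 : (lam : ℝ) * (2 / lam * a') ≤ lam * (2 * a' * s + q) :=
    mul_le_mul_of_nonneg_left h5 hlamR.le
  have h7 : (lam : ℝ) * (2 / lam * a') = 2 * a' := by field_simp
  linarith

theorem splitMergeBound_eq_top {n k : ℕ} {lam : ℝ} (hlam : 0 < lam) {σ : Measure ℝ}
    (h2 : orderStatMoment σ n k 2 = ⊤) : splitMergeBound lam σ n k = ⊤ := by
  have hl0 : ENNReal.ofReal lam ≠ 0 := by simpa using hlam
  have ht : 2 * (1 - ENNReal.ofReal lam * orderStatMoment σ n k 1) ≠ ⊤ :=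
    ENNReal.mul_ne_top ENNReal.ofNat_ne_top (ne_top_of_le_ne_top ENNReal.one_ne_top tsub_le_self)
  rw [splitMergeBound, h2, ENNReal.mul_top hl0, ENNReal.top_div_of_ne_top ht, add_top]

theorem purgingMean_le_splitMergeBound {n k : ℕ} (hk : 1 ≤ k) (hkn : k ≤ n) {lam : ℝ}
    (hlam : 0 < lam) {σ : Measure ℝ} [IsProbabilityMeasure σ] (hσ : ∀ᵐ x ∂σ, 0 ≤ x)
    (h1 : ENNReal.ofReal lam * orderStatMoment σ n k 1 < 1) :
    purgingMean lam σ n k ≤ splitMergeBound lam σ n k := by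
  by_cases h2 : orderStatMoment σ n k 2 = ⊤
  · rw [splitMergeBound_eq_top hlam h2]; exact le_top
  rw [purgingMean_eq_iSup hk hkn hlam]
  refine iSup_le fun j => ?_
  calc ∫⁻ ω, ENNReal.ofReal (backwardSojourn k j ω) ∂inputLaw lam σ n
      ≤ ∫⁻ ω, ENNReal.ofReal (splitMerge k (j + 1) ω) ∂inputLaw lam σ n :=
        lintegral_mono fun ω => ENNReal.ofReal_le_ofReal
          ((backwardSojourn_le_splitMerge hk hkn j ω).trans (splitMerge_mono k ω j.le_succ))
    _ = waitMoment lam σ n k j 1 + orderStatMoment σ n k 1 :=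
        lintegral_splitMerge_succ_one hk hkn hlam hσ j
    _ ≤ splitMergeBound lam σ n k := by
        rw [splitMergeBound, add_comm]
        gcongr
        exact waitMoment_one_le hk hkn hlam hσ h1 h2 j

/-! ### Finiteness of the basic means -/

theorem orderStatMoment_one_one (σ : Measure ℝ) [IsProbabilityMeasure σ] (p : ℕ) :
    orderStatMoment σ 1 1 p = ∫⁻ x, ENNReal.ofReal x ^ p ∂σ := by
  have h : ∀ x : Fin 1 → ℝ, orderStat 1 x = x 0 := fun x => eq_of_forall_ge_iff fun t => by
    rw [orderStat_card_le_iff le_rfl]; simp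
  have hm : Measurable fun x : ℝ => ENNReal.ofReal x ^ p := by fun_prop
  simp only [orderStatMoment, h]
  exact (measurePreserving_eval (fun _ : Fin 1 => σ) 0).lintegral_comp hm

/-- A maximum of nonnegative numbers is at most their sum, and each single node is a basic `(1,1)`
queue. -/
theorem basicMean_le_mul {n : ℕ} (hn : 1 ≤ n) {lam : ℝ} (hlam : 0 < lam) {σ : Measure ℝ}
    [IsProbabilityMeasure σ] (hσ : ∀ᵐ x ∂σ, 0 ≤ x) :
    basicMean lam σ n ≤ n * basicMean lam σ 1 := by
  rw [basicMean_eq_iSup hn hlam, basicMean_eq_iSup le_rfl hlam]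
  refine iSup_le fun j => ?_
  have hone : ∀ S ∈ Finset.powersetCard 1 (Finset.univ : Finset (Fin n)),
      ∫⁻ ω, ENNReal.ofReal (maxOver S (backward n j ω)) ∂inputLaw lam σ n =
      ∫⁻ ω, ENNReal.ofReal (backwardSojourn 1 j ω) ∂inputLaw lam σ 1 := fun S hS => by
    have hc := (Finset.mem_powersetCard.1 hS).2
    have := lintegral_maxOver_backward hlam σ (S := S) hc.ge j
    rw [this, hc]
  have hle : ∀ᵐ ω ∂inputLaw lam σ n, ENNReal.ofReal (backwardSojourn n j ω) ≤
      ∑ S ∈ Finset.powersetCard 1 (Finset.univ : Finset (Fin n)),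
        ENNReal.ofReal (maxOver S (backward n j ω)) := by
    filter_upwards [ae_inputLaw_nonneg hlam hσ n] with ω hω
    have h0 : ∀ S ∈ Finset.powersetCard 1 (Finset.univ : Finset (Fin n)),
        0 ≤ maxOver S (backward n j ω) := fun S hS =>
      maxOver_nonneg (Finset.mem_powersetCard.1 hS).2.ge (backward_nonneg j hω)
    rw [← ENNReal.ofReal_sum_of_nonneg h0]
    refine ENNReal.ofReal_le_ofReal ((orderStat_card_le_iff hn _ _).2 fun i => ?_)
    have hi : {i} ∈ Finset.powersetCard 1 (Finset.univ : Finset (Fin n)) := by simp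
    exact ((maxOver_le_iff (S := {i}) (by simp) (backward n j ω) _).1 le_rfl i (by simp)).trans
      (Finset.single_le_sum h0 hi)
  refine (lintegral_mono_ae hle).trans ?_
  have hmeas : ∀ S ∈ Finset.powersetCard 1 (Finset.univ : Finset (Fin n)),
      AEMeasurable (fun ω => ENNReal.ofReal (maxOver S (backward n j ω)))
        (inputLaw lam σ n) := fun S hS =>
    ((measurable_maxOver (Finset.mem_powersetCard.1 hS).2.ge).comp
      (measurable_backward hn le_rfl j)).ennreal_ofReal.aemeasurable
  rw [lintegral_finsetSum' _ hmeas, Finset.sum_congr rfl hone, Finset.sum_const, Finset.card_powersetCard, Finset.card_univ,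
    Fintype.card_fin, Nat.choose_one_right, nsmul_eq_mul]
  gcongr
  exact le_iSup (fun j => ∫⁻ ω, ENNReal.ofReal (backwardSojourn 1 j ω) ∂inputLaw lam σ 1) j

theorem basicMean_ne_top {n : ℕ} (hn : 1 ≤ n) {lam : ℝ} (hlam : 0 < lam) {σ : Measure ℝ}
    [IsProbabilityMeasure σ] (hσ : ∀ᵐ x ∂σ, 0 ≤ x)
    (h1 : ENNReal.ofReal lam * (∫⁻ x, ENNReal.ofReal x ∂σ) < 1)
    (h2 : (∫⁻ x, ENNReal.ofReal x ^ 2 ∂σ) ≠ ⊤) : basicMean lam σ n ≠ ⊤ := by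
  have e1 : orderStatMoment σ 1 1 1 = ∫⁻ x, ENNReal.ofReal x ∂σ := by
    simpa using orderStatMoment_one_one σ 1
  have hl0 : ENNReal.ofReal lam ≠ 0 := by simpa using hlam
  have h1t : orderStatMoment σ 1 1 1 ≠ ⊤ := fun h => by
    rw [← e1, h, ENNReal.mul_top hl0] at h1; exact not_top_lt h1
  rw [← e1] at h1
  refine ne_top_of_le_ne_top (ENNReal.mul_ne_top (ENNReal.natCast_ne_top n) ?_)
    (basicMean_le_mul hn hlam hσ)
  rw [← purgingMean_card]
  refine ne_top_of_le_ne_top ?_ (purgingMean_le_splitMergeBound le_rfl le_rfl hlam hσ h1)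
  rw [splitMergeBound, orderStatMoment_one_one σ 2]
  refine ENNReal.add_ne_top.2 ⟨h1t, (ENNReal.div_lt_top
    (ENNReal.mul_ne_top ENNReal.ofReal_ne_top h2) ?_).ne⟩
  exact mul_ne_zero two_ne_zero (tsub_pos_of_lt h1).ne'

end ForkJoin

end

theorem theorem8 (n k : ℕ) (hk : 1 ≤ k) (hkn : k ≤ n) (lam : ℝ) (hlam : 0 < lam)
    (σ : Measure ℝ) [IsProbabilityMeasure σ] (hσ : ∀ᵐ x ∂σ, 0 ≤ x) :
    ((ForkJoin.purgingMean lam σ n k : EReal) ≤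
      if ENNReal.ofReal lam ≥ 1 / ForkJoin.orderStatMoment σ n k 1 then
        ForkJoin.naiveBound lam σ n k
      else
        min (ForkJoin.naiveBound lam σ n k) (ForkJoin.splitMergeBound lam σ n k : EReal)) ∧
    (ENNReal.ofReal lam * (∫⁻ x, ENNReal.ofReal x ∂σ) < 1 →
      (∫⁻ x, ENNReal.ofReal x ^ 2 ∂σ) ≠ ⊤ →
      ∀ i ∈ Finset.Icc k n, ForkJoin.basicMean lam σ i ≠ ⊤) := by
  refine ⟨?_, fun h1 h2 i hi =>
    ForkJoin.basicMean_ne_top (hk.trans (Finset.mem_Icc.1 hi).1) hlam hσ h1 h2⟩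
  have hnaive := ForkJoin.purgingMean_le_naiveBound hk hkn hlam hσ
  split_ifs with h
  · exact hnaive
  refine le_min hnaive (EReal.coe_ennreal_le_coe_ennreal_iff.2
    (ForkJoin.purgingMean_le_splitMergeBound hk hkn hlam hσ ?_))
  -- The conventions agree: a zero mean gives product `0 < 1`, and an infinite mean is excluded
  -- since `1/∞ = 0` puts it in the other branch.
  exact ENNReal.mul_lt_of_lt_div (not_le.1 h)
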